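/- A $k\times n$ board is a $k\times n$ grid of squares ($k,n\ge 1$), two squares being adjacent if they are horizontally or vertically adjacent, in which every square has a colour from a fixed set $C$ of $c$ colours. A move $(v,d)$ consists of choosing a square $v$ and a colour $d\in C$ and giving colour $d$ to all squares of the monochromatic component of $v$ (the squares joined to $v$ by a path all of whose squares have the colour of $v$). For a board $B$ let $m(B)$ be the minimum number of moves after which all squares have the same colour ($c$-FREE-FLOOD-IT is the problem of computing $m(B)$), and for squares $u,v$ let $m_B(u,v)$ be the minimum number of moves after which $u$ and $v$ lie in the same monochromatic component. **Corollary.** Fix $k\ge 1$ and $c$. There are a program and a constant $K$, depending only on $k$ and $c$, such that the following holds for every $n\ge 1$, every $k\times n$ board $B$ coloured from $C$, every square $u$ incident with the left-hand edge of $B$ and every square $v$ incident with the right-hand edge of $B$. Given $n$, the colouring of $B$ and the rows of $u$ and $v$, the program computes $m_B(u,v)$ in at most $K n^4$ steps, and $$ m_B(u,v)\ \le\ m(B)\ \le\ m_B(u,v)+c(k-1). $$ So $m(B)$ can be approximated within an additive error of at most $c(k-1)$ in time $O(n^4)$. Here programs run on a random access machine with words of $O(\log n)$ bits (all numbers occurring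 are at most $K n^{K}$) on which each arithmetic operation, comparison and memory access costs one step. -/

import Mathlib

/-! ### The flooding game on a coloured graph -/

namespace FloodIt

section Game

variable {V C : Type*}

/-- The edges of `G` whose two ends have the same colour; its connected components are the
monochromatic components of the coloured graph. -/
def monoGraph (G : SimpleGraph V) (ω : V → C) : SimpleGraph V where
  Adj x y := G.Adj x y ∧ ω x = ω y
  symm := ⟨fun _ _ h => ⟨h.1.symm, h.2.symm⟩⟩
  loopless := ⟨fun x h => G.irrefl (v := x) h.1⟩

/-- `u` and `v` lie in the same monochromatic component. -/
def Linked (G : SimpleGraph V) (ω : V → C) (u v : V) : Prop :=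
  (monoGraph G ω).Reachable u v

open Classical in
/-- The move `(v, d)`: the monochromatic component of `v` receives colour `d`. -/
noncomputable def play (G : SimpleGraph V) (ω : V → C) (m : V × C) : V → C :=
  fun w => if Linked G ω m.1 w then m.2 else ω w

/-- The colouring obtained by playing a sequence of moves, from left to right. -/
noncomputable def playAll (G : SimpleGraph V) (ω : V → C) (S : List (V × C)) : V → C :=
  S.foldl (play G) ω

/-- The minimum number of moves that gives every vertex colour `d` (`⊤` if impossible). -/
noncomputable def floodMovesTo (G : SimpleGraph V) (ω : V → C) (d : C) : ℕ∞ :=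
  ⨅ S ∈ {S : List (V × C) | ∀ v, playAll G ω S v = d}, (S.length : ℕ∞)

/-- The minimum number of moves that makes the whole graph monochromatic. -/
noncomputable def floodMoves (G : SimpleGraph V) (ω : V → C) : ℕ∞ :=
  ⨅ d : C, floodMovesTo G ω d

/-- The minimum number of moves that links `u` and `v` by a monochromatic path of colour `d`
(`⊤` if impossible). -/
noncomputable def linkMovesTo (G : SimpleGraph V) (ω : V → C) (u v : V) (d : C) : ℕ∞ :=
  ⨅ S ∈ {S : List (V × C) | Linked G (playAll G ω S) u v ∧ playAll G ω S u = d},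
    (S.length : ℕ∞)

/-- The minimum number of moves that links `u` and `v`. -/
noncomputable def linkMoves (G : SimpleGraph V) (ω : V → C) (u v : V) : ℕ∞ :=
  ⨅ d : C, linkMovesTo G ω u v d

end Game

/-- The squares of a `k × n` board: (row, column). -/
abbrev Square (k n : ℕ) : Type := Fin k × Fin n

/-- Two squares are adjacent iff they are horizontally or vertically adjacent. -/
def boardGraph (k n : ℕ) : SimpleGraph (Square k n) :=
  (SimpleGraph.pathGraph k).boxProd (SimpleGraph.pathGraph n)

/-- The square in row `i` that is incident with the left-hand edge of the board. -/
def leftSquare {k n : ℕ} (hn : 0 < n) (i : Fin k) : Square k n := (i, ⟨0, hn⟩)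

/-- The square in row `i` that is incident with the right-hand edge of the board. -/
def rightSquare {k n : ℕ} (hn : 0 < n) (i : Fin k) : Square k n :=
  (i, ⟨n - 1, Nat.sub_lt hn Nat.one_pos⟩)

end FloodIt

/-! ### Word RAM programs with unit cost -/

namespace WordRAM

/-- Registers (addressed by constants of the program) and a random access memory. -/
@[ext] structure State where
  reg : ℕ → ℕ
  mem : ℕ → ℕ

/-- One elementary operation; the arguments are register numbers, except in `const`.
`sub` is truncated, `div` and `mod` are those of `ℕ`. -/
inductive Rhs : Type
  | const (v : ℕ)
  | reg (a : ℕ)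
  | add (a b : ℕ)
  | sub (a b : ℕ)
  | mul (a b : ℕ)
  | div (a b : ℕ)
  | mod (a b : ℕ)
  | load (a : ℕ)

def Rhs.eval (s : State) : Rhs → ℕ
  | .const v => v
  | .reg a => s.reg a
  | .add a b => s.reg a + s.reg b
  | .sub a b => s.reg a - s.reg b
  | .mul a b => s.reg a * s.reg b
  | .div a b => s.reg a / s.reg b
  | .mod a b => s.reg a % s.reg b
  | .load a => s.mem (s.reg a)

/-- Comparison of two registers. -/
inductive Test : Type
  | lt (a b : ℕ)
  | eq (a b : ℕ)

def Test.Holds (s : State) : Test → Prop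
  | .lt a b => s.reg a < s.reg b
  | .eq a b => s.reg a = s.reg b

/-- Programs. `assign r e` puts the result of `e` into register `r`; `store a b` writes register
`b` into the memory cell whose address is in register `a`. -/
inductive Prog : Type
  | skip
  | assign (r : ℕ) (e : Rhs)
  | store (a b : ℕ)
  | seq (p q : Prog)
  | ite (b : Test) (p q : Prog)
  | loop (b : Test) (p : Prog)

def State.setReg (s : State) (r v : ℕ) : State := ⟨Function.update s.reg r v, s.mem⟩

def State.setMem (s : State) (a v : ℕ) : State := ⟨s.reg, Function.update s.mem a v⟩

/-- `Exec W p s s' t`: started in state `s`, the program `p` halts in state `s'` after exactly `t`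
steps, every word written on the way being at most `W`. Each elementary operation and each test
is one step. There is no execution in which a larger word occurs. -/
inductive Exec (W : ℕ) : Prog → State → State → ℕ → Prop
  | skip (s : State) : Exec W .skip s s 0
  | assign (r : ℕ) (e : Rhs) (s : State) (h : e.eval s ≤ W) :
      Exec W (.assign r e) s (s.setReg r (e.eval s)) 1
  | store (a b : ℕ) (s : State) (ha : s.reg a ≤ W) (hb : s.reg b ≤ W) :
      Exec W (.store a b) s (s.setMem (s.reg a) (s.reg b)) 1
  | seq {p q : Prog} {s₁ s₂ s₃ : State} {t₁ t₂ : ℕ} (h₁ : Exec W p s₁ s₂ t₁)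
      (h₂ : Exec W q s₂ s₃ t₂) : Exec W (.seq p q) s₁ s₃ (t₁ + t₂)
  | ite_true {b : Test} {p q : Prog} {s s' : State} {t : ℕ} (hb : b.Holds s)
      (h : Exec W p s s' t) : Exec W (.ite b p q) s s' (t + 1)
  | ite_false {b : Test} {p q : Prog} {s s' : State} {t : ℕ} (hb : ¬ b.Holds s)
      (h : Exec W q s s' t) : Exec W (.ite b p q) s s' (t + 1)
  | loop_true {b : Test} {p : Prog} {s₁ s₂ s₃ : State} {t₁ t₂ : ℕ} (hb : b.Holds s₁)
      (h₁ : Exec W p s₁ s₂ t₁) (h₂ : Exec W (.loop b p) s₂ s₃ t₂) :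
      Exec W (.loop b p) s₁ s₃ (t₁ + t₂ + 1)
  | loop_false {b : Test} {p : Prog} {s : State} (hb : ¬ b.Holds s) :
      Exec W (.loop b p) s s 1

/-- Execution is deterministic: the final state and the number of steps are functions of the
program and the initial state. -/
theorem Exec.deterministic {W : ℕ} {p : Prog} {s s₁ s₂ : State} {t₁ t₂ : ℕ}
    (h₁ : Exec W p s s₁ t₁) (h₂ : Exec W p s s₂ t₂) : s₁ = s₂ ∧ t₁ = t₂ := by
  induction h₁ generalizing s₂ t₂ with
  | skip s => cases h₂; exact ⟨rfl, rfl⟩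
  | assign r e s h => cases h₂; exact ⟨rfl, rfl⟩
  | store a b s ha hb => cases h₂; exact ⟨rfl, rfl⟩
  | seq _ _ ih₁ ih₂ =>
    cases h₂ with
    | seq g₁ g₂ =>
      obtain ⟨rfl, rfl⟩ := ih₁ g₁
      obtain ⟨rfl, rfl⟩ := ih₂ g₂
      exact ⟨rfl, rfl⟩
  | ite_true hb _ ih =>
    cases h₂ with
    | ite_true _ g => obtain ⟨rfl, rfl⟩ := ih g; exact ⟨rfl, rfl⟩
    | ite_false hb' _ => exact absurd hb hb'
  | ite_false hb _ ih =>
    cases h₂ with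
    | ite_true hb' _ => exact absurd hb' hb
    | ite_false _ g => obtain ⟨rfl, rfl⟩ := ih g; exact ⟨rfl, rfl⟩
  | loop_true hb _ _ ih₁ ih₂ =>
    cases h₂ with
    | loop_true _ g₁ g₂ =>
      obtain ⟨rfl, rfl⟩ := ih₁ g₁
      obtain ⟨rfl, rfl⟩ := ih₂ g₂
      exact ⟨rfl, rfl⟩
    | loop_false hb' => exact absurd hb hb'
  | loop_false hb =>
    cases h₂ with
    | loop_true hb' _ _ => exact absurd hb' hb
    | loop_false _ => exact ⟨rfl, rfl⟩

end WordRAM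

namespace FloodIt

/-- The input: `n` and the two row numbers in registers `0`, `1`, `2`, and the colours of the
squares, row after row (the square in row `a` and column `b` at address `b + n * a`), in memory
cells `0, …, k * n - 1`; everything else is `0`. -/
def inputState {k n c : ℕ} (ω : Square k n → Fin c) (i j : Fin k) : WordRAM.State where
  reg r := if r = 0 then n else if r = 1 then i else if r = 2 then j else 0
  mem p := if h : p < k * n then (ω (finProdFinEquiv.symm ⟨p, h⟩) : ℕ) else 0

end FloodIt

/-! The cost of linking `u` and `v` obeys a recursion over walks, `Der`: single vertices are free,
two walks of equal colour joined by an edge add their costs, and changing the colour of a walk costs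
one. This recursion never looks at the rest of the graph, whereas a real move recolours a whole
component. The two notions nevertheless agree (`Der.exists_playAll`, `Linked.der_of_playAll`). A
component touched by a move is connected and monochromatic, so a walk that meets it several times
can be short-cut through it, and the move is paid for only once.

A derivation can be confined to a simple path (`Der.exists_pathDer`). Hence a table of costs indexed
by two squares and a colour, relaxed over all edges and colour pairs, is exact after `k * n` rounds
(`linkMovesTo_eq_table`). A round makes O(n^3) relaxations for fixed `k` and `c`, which gives O(n^4)
in total. The program performs the relaxations in place in a single loop whose counter encodes all
parameters as digits; `exists_exec_program` proves it correct and bounds its time and words.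

For the inequalities, a flooded board links every pair of squares. Conversely, a monochromatic
component joining the left and right edges meets every column, and playing all `c` colours in it
absorbs all its neighbours, so `k - 1` such rounds flood the board (`floodMoves_le_of_linked`). -/

namespace FloodIt

/-! ### Linking moves and derivations along walks -/

section LinkCost

variable {V C : Type*} {G : SimpleGraph V} {ω ω₁ ω₂ : V → C}

/-- `Der G ω u v d t`: some walk from `u` to `v` can be given colour `d` with `t` recolourings of
monochromatic subwalks, a walk being built by joining two walks of the same colour by an edge. -/
inductive Der (G : SimpleGraph V) (ω : V → C) : V → V → C → ℕ → Prop
  | single (u : V) : Der G ω u u (ω u) 0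
  | join {u x y v : V} {d : C} {s t : ℕ} (h₁ : Der G ω u x d s) (h : G.Adj x y)
      (h₂ : Der G ω y v d t) : Der G ω u v d (s + t)
  | recolour {u v : V} {d : C} {t : ℕ} (e : C) (h : Der G ω u v d t) : Der G ω u v e (t + 1)

theorem Der.mono {u v : V} {d : C} {s t : ℕ} (h : Der G ω u v d s) (hst : s ≤ t) :
    Der G ω u v d t := by
  induction t, hst using Nat.le_induction with
  | base => exact h
  | succ t _ ih => exact ih.recolour d

theorem Der.symm {u v : V} {d : C} {t : ℕ} (h : Der G ω u v d t) : Der G ω v u d t := by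
  induction h with
  | single u => exact .single u
  | join _ h _ ih₁ ih₂ => rw [add_comm]; exact ih₂.join h.symm ih₁
  | recolour e _ ih => exact ih.recolour e

theorem Linked.refl (u : V) : Linked G ω u u := SimpleGraph.Reachable.refl u

theorem Linked.symm {u v : V} (h : Linked G ω u v) : Linked G ω v u := SimpleGraph.Reachable.symm h

theorem Linked.trans {u v w : V} (h : Linked G ω u v) (h' : Linked G ω v w) : Linked G ω u w :=
  SimpleGraph.Reachable.trans h h'

theorem Linked.colour_eq {u v : V} (h : Linked G ω u v) : ω u = ω v := by
  obtain ⟨p⟩ := h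
  induction p with
  | nil => rfl
  | cons h _ ih => exact h.2.trans ih

theorem Linked.der {u v : V} (h : Linked G ω u v) : Der G ω u v (ω u) 0 := by
  obtain ⟨p⟩ := h
  induction p with
  | nil => exact .single _
  | cons h _ ih => exact (Der.single _).join h.1 (h.2 ▸ ih)

theorem Der.linked {u v : V} {d : C} {t : ℕ} (h : Der G ω u v d t) (ht : t = 0) :
    Linked G ω u v ∧ ω u = d := by
  induction h with
  | single u => exact ⟨SimpleGraph.Reachable.refl u, rfl⟩
  | join _ h _ ih₁ ih₂ =>
    obtain ⟨l₁, c₁⟩ := ih₁ (by omega)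
    obtain ⟨l₂, c₂⟩ := ih₂ (by omega)
    have hl : (monoGraph G ω).Adj _ _ := ⟨h, l₁.colour_eq.symm.trans (c₁.trans c₂.symm)⟩
    exact ⟨(l₁.trans hl.reachable).trans l₂, c₁⟩
  | recolour => omega

theorem play_of_linked {m : V × C} {w : V} (h : Linked G ω m.1 w) : play G ω m w = m.2 :=
  if_pos h

theorem play_of_not_linked {m : V × C} {w : V} (h : ¬ Linked G ω m.1 w) : play G ω m w = ω w :=
  if_neg h

/-- A component is recoloured as a whole, so moves never separate linked vertices. -/
theorem monoGraph_le_play (m : V × C) : monoGraph G ω ≤ monoGraph G (play G ω m) := by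
  intro x y h
  refine ⟨h.1, ?_⟩
  by_cases hx : Linked G ω m.1 x
  · rw [play_of_linked hx, play_of_linked (hx.trans h.reachable)]
  · have hy : ¬ Linked G ω m.1 y := fun hy => hx (hy.trans h.symm.reachable)
    rw [play_of_not_linked hx, play_of_not_linked hy, h.2]

theorem Linked.play {u v : V} (h : Linked G ω u v) (m : V × C) : Linked G (play G ω m) u v :=
  h.mono (monoGraph_le_play m)

theorem Linked.playAll {u v : V} (h : Linked G ω u v) (S : List (V × C)) :
    Linked G (playAll G ω S) u v := by
  induction S generalizing ω with
  | nil => exact h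
  | cons m S ih => exact ih (h.play m)

/-- A walk from `u` to `v` can be given colour `d` at cost `t`, and so can one that turns into the
set `A` at either end. -/
structure Through (G : SimpleGraph V) (ω : V → C) (A : Set V) (u v : V) (d : C) (t : ℕ) :
    Prop where
  der : Der G ω u v d t
  right : ∀ z ∈ A, Der G ω u z d t
  left : ∀ z ∈ A, Der G ω z v d t
  both : ∀ z ∈ A, ∀ z' ∈ A, Der G ω z z' d t

namespace Through

variable {A : Set V} {u v x y : V} {d : C} {s t : ℕ}

theorem symm (h : Through G ω A u v d t) : Through G ω A v u d t :=
  ⟨h.der.symm, fun z hz => (h.left z hz).symm, fun z hz => (h.right z hz).symm, h.both⟩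

theorem recolour (h : Through G ω A u v d t) (e : C) : Through G ω A u v e (t + 1) :=
  ⟨h.der.recolour e, fun z hz => (h.right z hz).recolour e, fun z hz => (h.left z hz).recolour e,
    fun z hz z' hz' => (h.both z hz z' hz').recolour e⟩

end Through

/-- A walk avoiding `A` keeps its derivation. Otherwise the piece after its last visit to `A` and
the piece before its first visit survive, each at no greater cost than the whole; a piece may be
empty, when the walk ends or starts in `A`. -/
theorem Der.transfer {A : Set V} (hA : ∀ z ∉ A, ω₁ z = ω₂ z) {u v : V} {d : C} {t : ℕ}
    (h : Der G ω₁ u v d t) :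
    Der G ω₂ u v d t ∨
      ((v ∈ A ∨ ∃ a ∈ A, ∃ y, G.Adj a y ∧ Der G ω₂ y v d t) ∧
        (u ∈ A ∨ ∃ a ∈ A, ∃ x, G.Adj x a ∧ Der G ω₂ u x d t)) := by
  induction h with
  | single u =>
    by_cases hu : u ∈ A
    · exact .inr ⟨.inl hu, .inl hu⟩
    · exact .inl (hA u hu ▸ .single u)
  | @join u x y v d s t _ h _ ih₁ ih₂ =>
    have right : (v ∈ A ∨ ∃ a ∈ A, ∃ y, G.Adj a y ∧ Der G ω₂ y v d t) →
        (v ∈ A ∨ ∃ a ∈ A, ∃ y, G.Adj a y ∧ Der G ω₂ y v d (s + t)) :=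
      Or.imp_right fun ⟨a, ha, z, hz, D⟩ => ⟨a, ha, z, hz, D.mono (Nat.le_add_left _ _)⟩
    have left : (u ∈ A ∨ ∃ a ∈ A, ∃ x, G.Adj x a ∧ Der G ω₂ u x d s) →
        (u ∈ A ∨ ∃ a ∈ A, ∃ x, G.Adj x a ∧ Der G ω₂ u x d (s + t)) :=
      Or.imp_right fun ⟨a, ha, z, hz, D⟩ => ⟨a, ha, z, hz, D.mono (Nat.le_add_right _ _)⟩
    rcases ih₁ with D₁ | ⟨r₁, l₁⟩ <;> rcases ih₂ with D₂ | ⟨r₂, l₂⟩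
    · exact .inl (D₁.join h D₂)
    · refine .inr ⟨right r₂, .inr ?_⟩
      rcases l₂ with hy | ⟨a, ha, z, hz, D₂⟩
      · exact ⟨y, hy, x, h, D₁.mono (Nat.le_add_right _ _)⟩
      · exact ⟨a, ha, z, hz, D₁.join h D₂⟩
    · refine .inr ⟨.inr ?_, left l₁⟩
      rcases r₁ with hx | ⟨a, ha, z, hz, D₁⟩
      · exact ⟨x, hx, y, h, D₂.mono (Nat.le_add_left _ _)⟩
      · exact ⟨a, ha, z, hz, D₁.join h D₂⟩
    · exact .inr ⟨right r₂, left l₁⟩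
  | recolour e _ ih =>
    refine ih.imp (·.recolour e) (And.imp ?_ ?_) <;>
    exact Or.imp_right fun ⟨a, ha, z, hz, D⟩ => ⟨a, ha, z, hz, D.recolour e⟩

/-- If the second walk meets `A`, only its piece after the last visit is needed: the first walk can
be diverted to the vertex of `A` where that piece starts, at unchanged cost. This is why `Through`
allows both ends to move freely in `A`. -/
theorem Through.join {A : Set V} (hA : ∀ z ∉ A, ω₁ z = ω₂ z) {u x y v : V} {d : C} {s t : ℕ}
    (h₁ : Through G ω₂ A u x d s) (h : G.Adj x y) (h₂ : Der G ω₁ y v d t) :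
    Through G ω₂ A u v d (s + t) := by
  have hs : s ≤ s + t := Nat.le_add_right _ _
  rcases h₂.transfer hA with D | ⟨hv | ⟨a, ha, z, hz, D⟩, -⟩
  · exact ⟨h₁.der.join h D, fun z hz => (h₁.right z hz).mono hs,
      fun z hz => (h₁.left z hz).join h D, fun z hz z' hz' => (h₁.both z hz z' hz').mono hs⟩
  · exact ⟨(h₁.right v hv).mono hs, fun z hz => (h₁.right z hz).mono hs,
      fun z hz => (h₁.both z hz v hv).mono hs, fun z hz z' hz' => (h₁.both z hz z' hz').mono hs⟩
  · exact ⟨(h₁.right a ha).join hz D, fun z hz => (h₁.right z hz).mono hs,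
      fun z hz' => (h₁.both z hz' a ha).join hz D,
      fun z hz z' hz' => (h₁.both z hz z' hz').mono hs⟩

theorem Through.join_left {A : Set V} (hA : ∀ z ∉ A, ω₁ z = ω₂ z) {u x y v : V} {d : C}
    {s t : ℕ} (h₁ : Der G ω₁ u x d s) (h : G.Adj x y) (h₂ : Through G ω₂ A y v d t) :
    Through G ω₂ A u v d (s + t) := by
  rw [add_comm]
  exact (h₂.symm.join hA h.symm h₁.symm).symm

/-- Undoing a move costs at most one, however often the walk uses the recoloured component: when
both halves of a join use it, the unit is charged to the first, and the second is cut by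
`Through.join`. -/
theorem Der.of_play {m : V × C} {u v : V} {d : C} {t : ℕ} (h : Der G (play G ω m) u v d t) :
    Der G ω u v d t ∨ Through G ω {z | Linked G ω m.1 z} u v d (t + 1) := by
  have hA : ∀ z ∉ {z | Linked G ω m.1 z}, play G ω m z = ω z := fun z hz => play_of_not_linked hz
  induction h with
  | single u =>
    by_cases hu : Linked G ω m.1 u
    · have key : ∀ z z', Linked G ω m.1 z → Linked G ω m.1 z' → Der G ω z z' m.2 (0 + 1) :=
        fun z z' hz hz' => by
          have := (hz.symm.trans hz').der.recolour m.2
          exact this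
      rw [play_of_linked hu]
      exact .inr ⟨key _ _ hu hu, fun z hz => key _ _ hu hz, fun z hz => key _ _ hz hu,
        fun z hz z' hz' => key _ _ hz hz'⟩
    · rw [play_of_not_linked hu]
      exact .inl (.single u)
  | @join u x y v d s t h₁ h h₂ ih₁ ih₂ =>
    rcases ih₁ with D₁ | T₁
    · rcases ih₂ with D₂ | T₂
      · exact .inl (D₁.join h D₂)
      · rw [add_assoc]
        exact .inr (T₂.join_left hA h₁ h)
    · rw [add_right_comm]
      exact .inr (T₁.join hA h h₂)
  | recolour e _ ih => exact ih.imp (·.recolour e) (·.recolour e)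

/-- The move is an innermost recolouring, whose subwalk is monochromatic. Its component may also
contain vertices of the other subwalks and spoil their derivations; `Through` repairs this by
short-cuts. -/
theorem Der.exists_play {u v : V} {d : C} {t : ℕ} (h : Der G ω u v d t) (ht : t ≠ 0) :
    ∃ m : V × C, Through G (play G ω m) {z | Linked G ω m.1 z} u v d (t - 1) := by
  induction h with
  | single => exact absurd rfl ht
  | @join u x y v d s t h₁ h h₂ ih₁ ih₂ =>
    by_cases hs : s = 0
    · obtain ⟨m, T⟩ := ih₂ (by omega)
      refine ⟨m, ?_⟩
      rw [show s + t - 1 = s + (t - 1) by omega]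
      exact T.join_left (fun z hz => (play_of_not_linked hz).symm) h₁ h
    · obtain ⟨m, T⟩ := ih₁ hs
      refine ⟨m, ?_⟩
      rw [show s + t - 1 = s - 1 + t by omega]
      exact T.join (fun z hz => (play_of_not_linked hz).symm) h h₂
  | @recolour u v d t e h ih =>
    -- At cost zero the subwalk lies in one component, so this recolouring is itself a legal move.
    by_cases ht0 : t = 0
    · subst ht0
      refine ⟨(u, e), ?_⟩
      have hl := (h.linked rfl).1
      have key : ∀ z z', Linked G ω u z → Linked G ω u z' →
          Der G (play G ω (u, e)) z z' e (0 + 1 - 1) := fun z z' hz hz' => by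
        have := ((hz.symm.trans hz').play (u, e)).der
        rwa [play_of_linked (m := (u, e)) hz] at this
      have hu : Linked G ω u u := SimpleGraph.Reachable.refl u
      exact ⟨key _ _ hu hl, fun z hz => key _ _ hu hz, fun z hz => key _ _ hz hl,
        fun z hz z' hz' => key _ _ hz hz'⟩
    · obtain ⟨m, T⟩ := ih ht0
      refine ⟨m, ?_⟩
      rw [show t + 1 - 1 = t - 1 + 1 by omega]
      exact T.recolour e

theorem Der.exists_playAll {u v : V} {d : C} {t : ℕ} (h : Der G ω u v d t) :
    ∃ S : List (V × C), S.length = t ∧ Linked G (FloodIt.playAll G ω S) u v ∧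
      FloodIt.playAll G ω S u = d := by
  induction t generalizing ω with
  | zero => exact ⟨[], rfl, h.linked rfl⟩
  | succ t ih =>
    obtain ⟨m, T⟩ := h.exists_play (Nat.succ_ne_zero t)
    obtain ⟨S, hS, hl⟩ := ih T.der
    exact ⟨m :: S, by rw [List.length_cons, hS], hl⟩

theorem Linked.der_of_playAll {u v : V} (S : List (V × C))
    (h : Linked G (FloodIt.playAll G ω S) u v) :
    Der G ω u v (FloodIt.playAll G ω S u) S.length := by
  induction S generalizing ω with
  | nil => exact h.der
  | cons m S ih =>
    rcases (ih (ω := FloodIt.play G ω m) h).of_play with D | T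
    · exact D.mono (Nat.le_succ _)
    · exact T.der

theorem linkMovesTo_eq {u v : V} {d : C} {t : ℕ} (h : Der G ω u v d t)
    (hmin : ∀ s, Der G ω u v d s → t ≤ s) : linkMovesTo G ω u v d = t := by
  apply le_antisymm
  · obtain ⟨S, hS, hl⟩ := h.exists_playAll
    exact (iInf₂_le S hl).trans (by rw [hS])
  · refine le_iInf₂ fun S hS => ?_
    have := hmin _ (hS.2 ▸ Linked.der_of_playAll S hS.1)
    exact_mod_cast this

/-! ### Reduction to simple paths -/

/-- `Der` along a walk without repeated vertices, with vertex set `A`. -/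
inductive PathDer (G : SimpleGraph V) (ω : V → C) : Finset V → V → V → C → ℕ → Prop
  | single (u : V) : PathDer G ω {u} u u (ω u) 0
  | join {A B D : Finset V} {u x y v : V} {d : C} {s t : ℕ} (h₁ : PathDer G ω A u x d s)
      (h : G.Adj x y) (h₂ : PathDer G ω B y v d t) (hAB : Disjoint A B)
      (hD : ∀ z, z ∈ D ↔ z ∈ A ∨ z ∈ B) : PathDer G ω D u v d (s + t)
  | recolour {A : Finset V} {u v : V} {d : C} {t : ℕ} (e : C) (h : PathDer G ω A u v d t) :
      PathDer G ω A u v e (t + 1)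

namespace PathDer

variable {A B : Finset V} {u x y v z : V} {d : C} {s t : ℕ}

theorem mono (h : PathDer G ω A u v d s) (hst : s ≤ t) : PathDer G ω A u v d t := by
  induction t, hst using Nat.le_induction with
  | base => exact h
  | succ t _ ih => exact ih.recolour d

theorem exists_suffix (h : PathDer G ω B y v d t) (hz : z ∈ B) :
    z = v ∨ ∃ B' ⊆ B, z ∉ B' ∧ ∃ y', G.Adj z y' ∧ PathDer G ω B' y' v d t := by
  classical
  induction h with
  | single u => exact .inl (Finset.mem_singleton.1 hz)
  | @join A B D u x y v d s t h₁ h h₂ hAB hD ih₁ ih₂ =>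
    rcases (hD z).1 hz with hA | hB
    · have hB : z ∉ B := Finset.disjoint_left.1 hAB hA
      refine .inr ?_
      rcases ih₁ hA with rfl | ⟨A', hA', hz', y', hy', P⟩
      · exact ⟨B, fun w hw => (hD w).2 (.inr hw), hB, y, h, h₂.mono (Nat.le_add_left _ _)⟩
      · refine ⟨A' ∪ B, fun w hw => (hD w).2 ((Finset.mem_union.1 hw).imp_left (hA' ·)), ?_, y', hy',
          P.join h h₂ (hAB.mono_left hA') fun w => Finset.mem_union⟩
        exact fun h => (Finset.mem_union.1 h).elim hz' hB
    · refine (ih₂ hB).imp_right ?_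
      rintro ⟨B', hB', hz', y', hy', P⟩
      exact ⟨B', fun w hw => (hD w).2 (.inr (hB' hw)), hz', y', hy',
        P.mono (Nat.le_add_left _ _)⟩
  | recolour e _ ih =>
    refine (ih hz).imp_right ?_
    rintro ⟨B', hB', hz', y', hy', P⟩
    exact ⟨B', hB', hz', y', hy', P.recolour e⟩

theorem exists_prefix (h : PathDer G ω A u x d s) (hAB : ¬ Disjoint A B) :
    ∃ z ∈ B, ∃ A', (∀ w ∈ A', w ∈ B → w = z) ∧ A' ⊆ A ∧ PathDer G ω A' u z d s := by
  classical
  induction h with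
  | single u =>
    rw [Finset.disjoint_singleton_left, not_not] at hAB
    exact ⟨u, hAB, {u}, fun w hw _ => Finset.mem_singleton.1 hw, subset_rfl, .single u⟩
  | @join A₁ A₂ D u x y v d s t h₁ h h₂ hA hD ih₁ ih₂ =>
    by_cases h' : Disjoint A₁ B
    · have h2 : ¬ Disjoint A₂ B := fun h2 => hAB <| Finset.disjoint_left.2 fun w hw =>
        ((hD w).1 hw).elim (Finset.disjoint_left.1 h' ·) (Finset.disjoint_left.1 h2 ·)
      obtain ⟨z, hz, A', hA', hs, P⟩ := ih₂ h2
      refine ⟨z, hz, A₁ ∪ A', fun w hw hwB => ?_, fun w hw => ?_,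
        h₁.join h P (hA.mono_right hs) fun w => Finset.mem_union⟩
      · exact (Finset.mem_union.1 hw).elim (fun hw => absurd hwB (Finset.disjoint_left.1 h' hw))
          fun hw => hA' w hw hwB
      · exact (hD w).2 ((Finset.mem_union.1 hw).imp_right (hs ·))
    · obtain ⟨z, hz, A', hA', hs, P⟩ := ih₁ h'
      exact ⟨z, hz, A', hA', fun w hw => (hD w).2 (.inl (hs hw)), P.mono (Nat.le_add_right _ _)⟩
  | recolour e _ ih =>
    obtain ⟨z, hz, A', hA', hs, P⟩ := ih hAB
    exact ⟨z, hz, A', hA', hs, P.recolour e⟩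

end PathDer

/-- Loop erasure at a join: the first path is stopped at its first vertex `z` on the second, which
is then entered just after `z`. Truncating a derivation does not raise its cost. -/
theorem Der.exists_pathDer {u v : V} {d : C} {t : ℕ} (h : Der G ω u v d t) :
    ∃ A, PathDer G ω A u v d t := by
  classical
  induction h with
  | single u => exact ⟨{u}, .single u⟩
  | @join u x y v d s t _ h _ ih₁ ih₂ =>
    obtain ⟨A, P⟩ := ih₁
    obtain ⟨B, Q⟩ := ih₂
    by_cases hAB : Disjoint A B
    · exact ⟨A ∪ B, P.join h Q hAB fun w => Finset.mem_union⟩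
    · obtain ⟨z, hz, A', hA', -, P'⟩ := P.exists_prefix hAB
      rcases Q.exists_suffix hz with rfl | ⟨B', hB', hzB, y', hy', Q'⟩
      · exact ⟨A', P'.mono (Nat.le_add_right _ _)⟩
      · refine ⟨A' ∪ B', P'.join hy' Q' (Finset.disjoint_left.2 fun w hw hw' => ?_)
          fun w => Finset.mem_union⟩
        exact hzB (hA' w hw (hB' hw') ▸ hw')
  | recolour e _ ih =>
    obtain ⟨A, P⟩ := ih
    exact ⟨A, P.recolour e⟩

open Classical in
/-- A table that is relaxed along all edges in each round bounds, after `r` rounds, the cost of all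
paths with at most `r + 1` vertices. -/
theorem PathDer.table_le {M : ℕ → V → V → C → ℕ} (h0 : ∀ u, M 0 u u (ω u) = 0)
    (h1 : ∀ u d, M 0 u u d ≤ 1)
    (hM : ∀ r u v d, M (r + 1) u v d ≤ M r u v d)
    (hstep : ∀ r u v x y d e, G.Adj x y →
      M (r + 1) u v e ≤ M r u x d + M r y v d + if d = e then 0 else 1)
    {A : Finset V} {u v : V} {d : C} {t : ℕ} (h : PathDer G ω A u v d t) {r : ℕ}
    (hr : A.card ≤ r + 1) (e : C) : M r u v e ≤ t + if d = e then 0 else 1 := by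
  have card_pos : ∀ {A : Finset V} {u v d t}, PathDer G ω A u v d t → 0 < A.card := by
    intro A u v d t h
    induction h with
    | single => simp
    | @join A B D u x y v d s t h₁ h h₂ hAB hD ih₁ ih₂ =>
      exact ih₁.trans_le (Finset.card_le_card fun z hz => (hD z).2 (.inl hz))
    | recolour _ _ ih => exact ih
  induction h generalizing r e with
  | single u =>
    have hr0 : M r u u e ≤ M 0 u u e := by
      clear hr
      induction r with
      | zero => exact le_rfl
      | succ r ih => exact (hM _ _ _ _).trans ih
    refine hr0.trans ?_
    split_ifs with he
    · rw [← he, h0]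
    · simpa using h1 u e
  | @join A B D u x y v d s t h₁ h h₂ hAB hD ih₁ ih₂ =>
    have hcard : D.card = A.card + B.card := by
      rw [← Finset.card_union_of_disjoint hAB]
      congr 1
      ext z
      rw [hD, Finset.mem_union]
    have hA := card_pos h₁
    have hB := card_pos h₂
    -- Both halves are nonempty and disjoint, so each has fewer vertices than the whole and is
    -- handled by the preceding round.
    obtain ⟨r, rfl⟩ : ∃ r', r = r' + 1 := ⟨r - 1, by omega⟩
    have i₁ := ih₁ (r := r) (by omega) d
    have i₂ := ih₂ (r := r) (by omega) d
    have := hstep r u v x y d e h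
    simp only [if_true] at i₁ i₂
    omega
  | recolour e' _ ih =>
    -- Recolouring to `e'` is skipped and the target `e` is used at once; the extra unit in the cost
    -- pays for it.
    have := ih hr e
    split_ifs at this ⊢ <;> omega

/-- Every walk can be given any colour by recolouring its vertices one by one. -/
theorem Der.of_walk {u v : V} (p : G.Walk u v) (d : C) : Der G ω u v d (p.length + 1) := by
  induction p with
  | nil => exact (Der.single _).recolour d
  | cons h p ih =>
    rw [SimpleGraph.Walk.length_cons, add_comm]
    exact ((Der.single _).recolour d).join h ih

theorem Der.card [Fintype V] (hG : G.Connected) (u v : V) (d : C) :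
    Der G ω u v d (Fintype.card V) := by
  obtain ⟨p, hp⟩ := (hG.preconnected u v).exists_isPath
  exact (Der.of_walk p d).mono hp.length_lt

/-- All moves are made in the component of `p`, so `y` keeps its colour until absorbed, which
happens at the latest when that colour is played. -/
theorem linked_playAll_of_adj {p x y : V} (S : List (V × C)) (hS : ∀ m ∈ S, m.1 = p)
    (hx : Linked G ω p x) (h : G.Adj x y) (hy : (p, ω y) ∈ S) :
    Linked G (playAll G ω S) p y := by
  induction S generalizing ω with
  | nil => simp at hy
  | cons m S ih =>
    by_cases hl : Linked G ω p y
    · exact hl.playAll (m :: S)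
    have hmp : m.1 = p := hS m List.mem_cons_self
    have hy' : play G ω m y = ω y := play_of_not_linked (by rwa [hmp])
    rcases List.mem_cons.1 hy with rfl | hy
    · have hadj : (monoGraph G (play G ω (p, ω y))).Adj x y := by
        refine ⟨h, ?_⟩
        rw [hy', play_of_linked (m := (p, ω y)) hx]
      exact Linked.playAll (SimpleGraph.Reachable.trans (hx.play _) hadj.reachable) S
    · exact ih (fun m hm => hS m (List.mem_cons_of_mem _ hm)) (hx.play m) (by rwa [hy'])

end LinkCost

/-! ### From a left-right link to a flooded board -/

section Board

variable {k n c : ℕ}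

theorem boardGraph_connected (hk : 0 < k) (hn : 0 < n) : (boardGraph k n).Connected := by
  obtain ⟨k, rfl⟩ := Nat.exists_eq_succ_of_ne_zero hk.ne'
  obtain ⟨n, rfl⟩ := Nat.exists_eq_succ_of_ne_zero hn.ne'
  exact (SimpleGraph.pathGraph_connected k).boxProd (SimpleGraph.pathGraph_connected n)

theorem boardGraph_adj {x y : Square k n} : (boardGraph k n).Adj x y ↔
    ((x.1 : ℕ) + 1 = y.1 ∨ (y.1 : ℕ) + 1 = x.1) ∧ x.2 = y.2 ∨
      ((x.2 : ℕ) + 1 = y.2 ∨ (y.2 : ℕ) + 1 = x.2) ∧ x.1 = y.1 := by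
  simp only [boardGraph, SimpleGraph.boxProd_adj, SimpleGraph.pathGraph_adj]

/-- Discrete intermediate values: the column changes by at most one per step. -/
theorem Linked.exists_column {C : Type*} {ω : Square k n → C} {x y : Square k n}
    (h : Linked (boardGraph k n) ω x y) {b : Fin n} (hx : x.2 ≤ b) (hy : b ≤ y.2) :
    ∃ a, Linked (boardGraph k n) ω x (a, b) := by
  obtain ⟨p⟩ := h
  induction p with
  | @nil u => exact ⟨u.1, (le_antisymm hx hy) ▸ SimpleGraph.Reachable.refl u⟩
  | @cons u w v h p ih =>
    by_cases hb : u.2 = b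
    · exact ⟨u.1, hb ▸ SimpleGraph.Reachable.refl u⟩
    · have hw : w.2 ≤ b := by
        have := boardGraph_adj.1 h.1
        simp only [Fin.ext_iff, Fin.le_def] at *
        omega
      obtain ⟨a, ha⟩ := ih hw hy
      exact ⟨a, h.reachable.trans ha⟩

/-- The component of `p` contains an interval of radius `r` (clipped to the board) in each
column. -/
def Covers {C : Type*} (ω : Square k n → C) (p : Square k n) (r : ℕ) : Prop :=
  ∀ b : Fin n, ∃ a₀ : Fin k, ∀ a : Fin k, (a : ℕ) ≤ a₀ + r → (a₀ : ℕ) ≤ a + r →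
    Linked (boardGraph k n) ω p (a, b)

theorem Covers.playAll {ω : Square k n → Fin c} {p : Square k n} {r : ℕ} (h : Covers ω p r) :
    Covers (playAll (boardGraph k n) ω ((List.finRange c).map fun d => (p, d))) p (r + 1) := by
  intro b
  obtain ⟨a₀, ha₀⟩ := h b
  refine ⟨a₀, fun a h₁ h₂ => ?_⟩
  have step : ∀ a' : Fin k, ((a' : ℕ) + 1 = a ∨ (a : ℕ) + 1 = a') →
      Linked (boardGraph k n) ω p (a', b) → Linked (boardGraph k n)
        (FloodIt.playAll (boardGraph k n) ω ((List.finRange c).map fun d => (p, d))) p (a, b) := by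
    intro a' ha' hl
    refine linked_playAll_of_adj _ ?_ hl (boardGraph_adj.2 (.inl ⟨ha', rfl⟩)) ?_
    · intro m hm
      obtain ⟨d, -, rfl⟩ := List.mem_map.1 hm
      rfl
    · exact List.mem_map_of_mem (List.mem_finRange _)
  -- A square outside the old interval has its neighbour one row nearer to `a₀` inside it.
  by_cases h₃ : (a : ℕ) ≤ a₀ + r
  · by_cases h₄ : (a₀ : ℕ) ≤ a + r
    · exact (ha₀ a h₃ h₄).playAll _
    · have := a₀.2
      exact step ⟨a + 1, by omega⟩ (.inr rfl) (ha₀ _ (by simp only; omega) (by simp only; omega))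
  · have := a.2
    exact step ⟨a - 1, by omega⟩ (.inl (by simp only; omega))
      (ha₀ _ (by simp only; omega) (by simp only; omega))

theorem Covers.exists_playAll {ω : Square k n → Fin c} {p : Square k n} (h : Covers ω p 0)
    (r : ℕ) : ∃ S : List (Square k n × Fin c), S.length = c * r ∧
      Covers (FloodIt.playAll (boardGraph k n) ω S) p r := by
  induction r with
  | zero => exact ⟨[], by simp, h⟩
  | succ r ih =>
    obtain ⟨S, hS, hc⟩ := ih
    refine ⟨S ++ (List.finRange c).map fun d => (p, d), by simp [hS, mul_add], ?_⟩
    rw [FloodIt.playAll, List.foldl_append]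
    exact hc.playAll

theorem floodMoves_le_of_linked (hn : 0 < n) (ω : Square k n → Fin c) (i j : Fin k)
    (S : List (Square k n × Fin c))
    (h : Linked (boardGraph k n) (playAll (boardGraph k n) ω S) (leftSquare hn i)
      (rightSquare hn j)) :
    floodMoves (boardGraph k n) ω ≤ (S.length : ℕ∞) + ((c * (k - 1) : ℕ) : ℕ∞) := by
  have h0 : Covers (playAll (boardGraph k n) ω S) (leftSquare hn i) 0 := by
    intro b
    obtain ⟨a, ha⟩ := h.exists_column (b := b) (Fin.le_def.2 (Nat.zero_le _))
      (Fin.le_def.2 (Nat.le_sub_one_of_lt b.2))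
    refine ⟨a, fun a' h₁ h₂ => ?_⟩
    rwa [show a' = a from Fin.ext (by omega)]
  -- Two rows differ by at most `k - 1`, so this radius covers every column.
  obtain ⟨S', hS', hc⟩ := h0.exists_playAll (k - 1)
  have hall : ∀ v, playAll (boardGraph k n) ω (S ++ S') v =
      playAll (boardGraph k n) ω (S ++ S') (leftSquare hn i) := by
    rintro ⟨a, b⟩
    obtain ⟨a₀, ha₀⟩ := hc b
    have := (ha₀ a (by omega) (by omega)).colour_eq
    rw [playAll, List.foldl_append]
    exact this.symm
  refine (iInf_le _ (playAll (boardGraph k n) ω (S ++ S') (leftSquare hn i))).trans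
    ((iInf₂_le (S ++ S') hall).trans ?_)
  rw [List.length_append, hS']
  push_cast
  rfl

theorem floodMoves_le_linkMoves_add (hn : 0 < n) (ω : Square k n → Fin c) (i j : Fin k) :
    floodMoves (boardGraph k n) ω ≤
      linkMoves (boardGraph k n) ω (leftSquare hn i) (rightSquare hn j) +
        ((c * (k - 1) : ℕ) : ℕ∞) := by
  rw [linkMoves, ENat.iInf_add]
  refine le_iInf fun d => ?_
  rw [linkMovesTo, ENat.iInf₂_add]
  exact le_iInf₂ fun S hS => floodMoves_le_of_linked hn ω i j S hS.1

theorem linkMoves_le_floodMoves (hk : 0 < k) (hn : 0 < n) (ω : Square k n → Fin c)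
    (u v : Square k n) :
    linkMoves (boardGraph k n) ω u v ≤ floodMoves (boardGraph k n) ω := by
  refine iInf_mono fun d => le_iInf₂ fun S hS => iInf₂_le S ⟨?_, hS u⟩
  refine ((boardGraph_connected hk hn).preconnected u v).mono fun x y h => ⟨h, ?_⟩
  rw [hS x, hS y]

end Board

end FloodIt

/-! ### Compiling expressions and loops to the word RAM -/

namespace WordRAM

/-- Binary operations on words. -/
inductive Op : Type
  | add
  | sub
  | mul
  | div
  | mod

def Op.eval : Op → ℕ → ℕ → ℕ
  | .add, x, y => x + y
  | .sub, x, y => x - y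
  | .mul, x, y => x * y
  | .div, x, y => x / y
  | .mod, x, y => x % y

def Op.rhs : Op → ℕ → ℕ → Rhs
  | .add => .add
  | .sub => .sub
  | .mul => .mul
  | .div => .div
  | .mod => .mod

theorem Op.eval_rhs (o : Op) (a b : ℕ) (s : State) :
    (o.rhs a b).eval s = o.eval (s.reg a) (s.reg b) := by
  cases o <;> rfl

theorem Op.eval_le (o : Op) (x y : ℕ) : o.eval x y ≤ x + y + x * y := by
  cases o <;> simp only [Op.eval]
  · omega
  · omega
  · omega
  · have := Nat.div_le_self x y; omega
  · have := Nat.mod_le x y; omega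

/-- Expressions; `ifLt a b x y` is `x` if `a < b` and `y` otherwise. -/
inductive Ex : Type
  | const (v : ℕ)
  | reg (a : ℕ)
  | bin (o : Op) (x y : Ex)
  | load (x : Ex)
  | ifLt (a b x y : Ex)

namespace Ex

instance : Add Ex := ⟨.bin .add⟩
instance : Sub Ex := ⟨.bin .sub⟩
instance : Mul Ex := ⟨.bin .mul⟩
instance : Div Ex := ⟨.bin .div⟩
instance : Mod Ex := ⟨.bin .mod⟩

def eval (s : State) : Ex → ℕ
  | .const v => v
  | .reg a => s.reg a
  | .bin o x y => o.eval (x.eval s) (y.eval s)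
  | .load x => s.mem (x.eval s)
  | .ifLt a b x y => if a.eval s < b.eval s then x.eval s else y.eval s

section Eval

variable (s : State) (v a : ℕ) (x y z w : Ex)

@[simp] theorem eval_const : (const v).eval s = v := rfl
@[simp] theorem eval_reg : (reg a).eval s = s.reg a := rfl
@[simp] theorem eval_add : (x + y).eval s = x.eval s + y.eval s := rfl
@[simp] theorem eval_sub : (x - y).eval s = x.eval s - y.eval s := rfl
@[simp] theorem eval_mul : (x * y).eval s = x.eval s * y.eval s := rfl
@[simp] theorem eval_div : (x / y).eval s = x.eval s / y.eval s := rfl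
@[simp] theorem eval_mod : (x % y).eval s = x.eval s % y.eval s := rfl
@[simp] theorem eval_load : (load x).eval s = s.mem (x.eval s) := rfl
@[simp] theorem eval_ifLt : (ifLt x y z w).eval s =
    if x.eval s < y.eval s then z.eval s else w.eval s := rfl

end Eval

/-- All registers occurring in the expression are smaller than `m`. -/
def Uses (m : ℕ) : Ex → Prop
  | .const _ => True
  | .reg a => a < m
  | .bin _ x y => x.Uses m ∧ y.Uses m
  | .load x => x.Uses m
  | .ifLt a b x y => a.Uses m ∧ b.Uses m ∧ x.Uses m ∧ y.Uses m

section Uses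

variable (m v a : ℕ) (x y z w : Ex)

@[simp] theorem uses_const : (const v).Uses m := trivial
@[simp] theorem uses_reg : (reg a).Uses m ↔ a < m := Iff.rfl
@[simp] theorem uses_add : (x + y).Uses m ↔ x.Uses m ∧ y.Uses m := Iff.rfl
@[simp] theorem uses_sub : (x - y).Uses m ↔ x.Uses m ∧ y.Uses m := Iff.rfl
@[simp] theorem uses_mul : (x * y).Uses m ↔ x.Uses m ∧ y.Uses m := Iff.rfl
@[simp] theorem uses_div : (x / y).Uses m ↔ x.Uses m ∧ y.Uses m := Iff.rfl
@[simp] theorem uses_mod : (x % y).Uses m ↔ x.Uses m ∧ y.Uses m := Iff.rfl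
@[simp] theorem uses_load : (load x).Uses m ↔ x.Uses m := Iff.rfl
@[simp] theorem uses_ifLt : (ifLt x y z w).Uses m ↔
    x.Uses m ∧ y.Uses m ∧ z.Uses m ∧ w.Uses m := Iff.rfl

end Uses

theorem eval_congr {m : ℕ} {e : Ex} (he : e.Uses m) {s s' : State}
    (hr : ∀ r < m, s.reg r = s'.reg r) (hm : s.mem = s'.mem) : e.eval s = e.eval s' := by
  induction e with
  | const v => rfl
  | reg a => exact hr a he
  | bin o x y ihx ihy => rw [eval, eval, ihx he.1, ihy he.2]
  | load x ih => rw [eval, eval, ih he, hm]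
  | ifLt a b x y iha ihb ihx ihy =>
    rw [eval, eval, iha he.1, ihb he.2.1, ihx he.2.2.1, ihy he.2.2.2]

/-- A program that puts the value of the expression into register `r`, using the registers above
`r` as temporary storage. -/
def compile : Ex → ℕ → Prog
  | .const v, r => .assign r (.const v)
  | .reg a, r => .assign r (.reg a)
  | .bin o x y, r => .seq (x.compile r) (.seq (y.compile (r + 1)) (.assign r (o.rhs r (r + 1))))
  | .load x, r => .seq (x.compile r) (.assign r (.load r))
  | .ifLt a b x y, r => .seq (a.compile r) (.seq (b.compile (r + 1))
      (.ite (.lt r (r + 1)) (x.compile r) (y.compile r)))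

/-- Expressions are evaluated in constant time, all words being polynomially bounded. -/
theorem exec_compile (m : ℕ) (e : Ex) (he : e.Uses m) : ∃ C, ∀ X, 1 ≤ X → ∀ s : State,
    (∀ r < m, s.reg r ≤ X) → (∀ p, s.mem p ≤ X) → e.eval s ≤ C * X ^ C ∧
      ∀ W, C * X ^ C ≤ W → ∀ r, m ≤ r → ∃ s' t, Exec W (e.compile r) s s' t ∧ t ≤ C ∧
        s'.mem = s.mem ∧ (∀ i < r, s'.reg i = s.reg i) ∧ s'.reg r = e.eval s := by
  have mono : ∀ {C D X W : ℕ}, 1 ≤ X → C ≤ D → D * X ^ D ≤ W → C * X ^ C ≤ W :=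
    fun hX h hW => le_trans (Nat.mul_le_mul h (Nat.pow_le_pow_right hX h)) hW
  have setReg_mem : ∀ (s : State) (r v : ℕ), (s.setReg r v).mem = s.mem := fun _ _ _ => rfl
  have setReg_same : ∀ (s : State) (r v : ℕ), (s.setReg r v).reg r = v :=
    fun _ _ _ => Function.update_self ..
  have setReg_lt : ∀ (s : State) (r v i : ℕ), i < r → (s.setReg r v).reg i = s.reg i :=
    fun _ _ _ _ h => Function.update_of_ne h.ne ..
  induction e with
  | const v =>
    refine ⟨v + 1, fun X hX s _ _ => ?_⟩
    have hv : v ≤ (v + 1) * X ^ (v + 1) :=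
      (Nat.le_succ v).trans (Nat.le_mul_of_pos_right _ (Nat.pow_pos hX))
    exact ⟨hv, fun W hW r _ => ⟨_, _, .assign r (.const v) s (hv.trans hW), by omega,
      setReg_mem .., setReg_lt _ _ _, setReg_same ..⟩⟩
  | reg a =>
    refine ⟨1, fun X hX s hr _ => ?_⟩
    have hv : s.reg a ≤ 1 * X ^ 1 := by simpa using hr a he
    exact ⟨hv, fun W hW r _ => ⟨_, _, .assign r (.reg a) s (hv.trans hW), le_rfl,
      setReg_mem .., setReg_lt _ _ _, setReg_same ..⟩⟩
  | bin o x y ihx ihy =>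
    obtain ⟨C, hC⟩ := ihx he.1
    obtain ⟨D, hD⟩ := ihy he.2
    -- `E` bounds both the exponent `C + D` of the product term and the sum of all coefficients.
    set E := C + D + C * D + 1 with hE
    refine ⟨E, fun X hX s hr hm => ?_⟩
    obtain ⟨bx, hx⟩ := hC X hX s hr hm
    obtain ⟨by', -⟩ := hD X hX s hr hm
    have hv : (bin o x y).eval s ≤ E * X ^ E := by
      have pow : ∀ i ≤ E, X ^ i ≤ X ^ E := fun i hi => Nat.pow_le_pow_right hX hi
      calc (bin o x y).eval s ≤ x.eval s + y.eval s + x.eval s * y.eval s := o.eval_le _ _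
        _ ≤ C * X ^ C + D * X ^ D + (C * X ^ C) * (D * X ^ D) := by gcongr
        _ = C * X ^ C + D * X ^ D + (C * D) * X ^ (C + D) := by rw [pow_add]; ring
        _ ≤ C * X ^ E + D * X ^ E + (C * D) * X ^ E := by
          gcongr <;> first | exact hX | (rw [hE]; nlinarith)
        _ = (C + D + C * D) * X ^ E := by ring
        _ ≤ E * X ^ E := Nat.mul_le_mul_right _ (by omega)
    refine ⟨hv, fun W hW r hmr => ?_⟩
    obtain ⟨s₁, t₁, e₁, ht₁, hm₁, hr₁, hv₁⟩ := hx W (mono hX (by omega) hW) r hmr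
    have hr₁' : ∀ r < m, s₁.reg r = s.reg r := fun i hi => hr₁ i (hi.trans_le hmr)
    obtain ⟨s₂, t₂, e₂, ht₂, hm₂, hr₂, hv₂⟩ :=
      (hD X hX s₁ (fun i hi => hr₁' i hi ▸ hr i hi) (fun p => hm₁ ▸ hm p)).2 W
        (mono hX (by omega) hW) (r + 1) (by omega)
    have hval : (o.rhs r (r + 1)).eval s₂ = (bin o x y).eval s := by
      rw [o.eval_rhs, hr₂ r (by omega), hv₁, hv₂, eval_congr he.2 hr₁' hm₁, eval]
    refine ⟨_, _, .seq e₁ (.seq e₂ (.assign r _ s₂ (hval ▸ hv.trans hW))), by omega, ?_, ?_, ?_⟩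
    · rw [setReg_mem, hm₂, hm₁]
    · intro i hi
      rw [setReg_lt _ _ _ _ hi, hr₂ i (by omega), hr₁ i hi]
    · rw [setReg_same, hval]
  | load x ih =>
    obtain ⟨C, hC⟩ := ih he
    refine ⟨C + 1, fun X hX s hr hm => ?_⟩
    obtain ⟨-, hx⟩ := hC X hX s hr hm
    have hv : (load x).eval s ≤ (C + 1) * X ^ (C + 1) :=
      (hm _).trans ((Nat.le_self_pow (Nat.succ_ne_zero C) X).trans
        (Nat.le_mul_of_pos_left _ (Nat.succ_pos C)))
    refine ⟨hv, fun W hW r hmr => ?_⟩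
    obtain ⟨s₁, t₁, e₁, ht₁, hm₁, hr₁, hv₁⟩ := hx W (mono hX (by omega) hW) r hmr
    have hval : (Rhs.load r).eval s₁ = (load x).eval s := by
      rw [Rhs.eval, hv₁, hm₁, eval]
    refine ⟨_, _, .seq e₁ (.assign r _ s₁ (hval ▸ hv.trans hW)), by omega, ?_, ?_, ?_⟩
    · rw [setReg_mem, hm₁]
    · intro i hi
      rw [setReg_lt _ _ _ _ hi, hr₁ i hi]
    · rw [setReg_same, hval]
  | ifLt a b x y iha ihb ihx ihy =>
    obtain ⟨ha, hb, hx, hy⟩ := he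
    obtain ⟨Ca, hCa⟩ := iha ha
    obtain ⟨Cb, hCb⟩ := ihb hb
    obtain ⟨Cx, hCx⟩ := ihx hx
    obtain ⟨Cy, hCy⟩ := ihy hy
    refine ⟨Ca + Cb + Cx + Cy + 1, fun X hX s hr hm => ⟨?_, fun W hW r hmr => ?_⟩⟩
    · rw [eval]
      split_ifs
      · exact (hCx X hX s hr hm).1.trans (mono hX (by omega) le_rfl)
      · exact (hCy X hX s hr hm).1.trans (mono hX (by omega) le_rfl)
    obtain ⟨s₁, t₁, e₁, ht₁, hm₁, hr₁, hv₁⟩ :=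
      (hCa X hX s hr hm).2 W (mono hX (by omega) hW) r hmr
    have hr₁' : ∀ r < m, s₁.reg r = s.reg r := fun i hi => hr₁ i (hi.trans_le hmr)
    obtain ⟨s₂, t₂, e₂, ht₂, hm₂, hr₂, hv₂⟩ :=
      (hCb X hX s₁ (fun i hi => hr₁' i hi ▸ hr i hi) (fun p => hm₁ ▸ hm p)).2 W
        (mono hX (by omega) hW) (r + 1) (by omega)
    have hm₂' : s₂.mem = s.mem := hm₂.trans hm₁
    have hr₂' : ∀ i < r, s₂.reg i = s.reg i := fun i hi => (hr₂ i (by omega)).trans (hr₁ i hi)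
    have hr₂m : ∀ i < m, s₂.reg i = s.reg i := fun i hi => hr₂' i (hi.trans_le hmr)
    have htest : (Test.lt r (r + 1)).Holds s₂ ↔ a.eval s < b.eval s := by
      rw [Test.Holds, hr₂ r (by omega), hv₁, hv₂, eval_congr hb hr₁' hm₁]
    by_cases hlt : a.eval s < b.eval s
    · obtain ⟨s₃, t₃, e₃, ht₃, hm₃, hr₃, hv₃⟩ :=
        (hCx X hX s₂ (fun i hi => hr₂m i hi ▸ hr i hi) (fun p => hm₂' ▸ hm p)).2 W
          (mono hX (by omega) hW) r hmr
      refine ⟨_, _, .seq e₁ (.seq e₂ (.ite_true (htest.2 hlt) e₃)), by omega, hm₃.trans hm₂',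
        fun i hi => (hr₃ i hi).trans (hr₂' i hi), ?_⟩
      rw [hv₃, eval, if_pos hlt, eval_congr hx hr₂m hm₂']
    · obtain ⟨s₃, t₃, e₃, ht₃, hm₃, hr₃, hv₃⟩ :=
        (hCy X hX s₂ (fun i hi => hr₂m i hi ▸ hr i hi) (fun p => hm₂' ▸ hm p)).2 W
          (mono hX (by omega) hW) r hmr
      refine ⟨_, _, .seq e₁ (.seq e₂ (.ite_false (fun h => hlt (htest.1 h)) e₃)), by omega,
        hm₃.trans hm₂', fun i hi => (hr₃ i hi).trans (hr₂' i hi), ?_⟩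
      rw [hv₃, eval, if_neg hlt, eval_congr hy hr₂m hm₂']

/-- Assigns the value of an expression in the registers below `6` to register `a`. -/
def set (a : ℕ) (e : Ex) : Prog := .seq (e.compile 6) (.assign a (.reg 6))

theorem exec_set {a : ℕ} {e : Ex} (he : e.Uses 6) : ∃ C, ∀ X, 1 ≤ X → ∀ s : State,
    (∀ r < 6, s.reg r ≤ X) → (∀ p, s.mem p ≤ X) → ∀ W, C * X ^ C ≤ W →
      ∃ s' t, Exec W (set a e) s s' t ∧ t ≤ C ∧ s'.mem = s.mem ∧
        (∀ i < 6, i ≠ a → s'.reg i = s.reg i) ∧ s'.reg a = e.eval s := by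
  obtain ⟨C, hC⟩ := exec_compile 6 e he
  refine ⟨C + 1, fun X hX s hr hm W hW => ?_⟩
  have hW' : C * X ^ C ≤ W := le_trans
    (Nat.mul_le_mul (Nat.le_succ C) (Nat.pow_le_pow_right hX (Nat.le_succ C))) hW
  obtain ⟨b, h⟩ := hC X hX s hr hm
  obtain ⟨s', t, h₁, h₂, h₃, h₄, h₅⟩ := h W hW' 6 le_rfl
  refine ⟨_, _, .seq h₁ (.assign a (.reg 6) s' ?_), Nat.succ_le_succ h₂, h₃, fun i hi hia => ?_, ?_⟩
  · rw [Rhs.eval, h₅]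
    exact b.trans hW'
  · exact (Function.update_of_ne hia ..).trans (h₄ i hi)
  · exact (Function.update_self ..).trans h₅

/-- While register `4` is less than register `5`: put the value of `B` into the memory cell with
address `A`, and increment register `4`. -/
def fill (A B : Ex) : Prog :=
  .loop (.lt 4 5) (.seq (A.compile 6) (.seq (B.compile 7) (.seq (.store 6 7)
    (.seq (.assign 8 (.const 1)) (.assign 4 (.add 4 8))))))

/-- The memory after `q` rounds of the loop `fill A B`. -/
def run (A B : Ex) (ρ mem : ℕ → ℕ) : ℕ → ℕ → ℕ
  | 0 => mem
  | q + 1 => Function.update (run A B ρ mem q)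
      (A.eval ⟨Function.update ρ 4 q, run A B ρ mem q⟩)
      (B.eval ⟨Function.update ρ 4 q, run A B ρ mem q⟩)

/-- This separates execution from the pure recursion `run`: later arguments about tables need only
`run`, plus a bound `X` on all intermediate memories. -/
theorem exec_fill {A B : Ex} (hA : A.Uses 6) (hB : B.Uses 6) : ∃ C, ∀ X, 1 ≤ X →
    ∀ ρ mem : ℕ → ℕ, (∀ r < 6, ρ r ≤ X) → (∀ q ≤ ρ 5, ∀ p, run A B ρ mem q p ≤ X) →
      ∀ W, C * X ^ C ≤ W → ∀ s : State, s.mem = mem → s.reg 4 = 0 →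
        (∀ i < 6, i ≠ 4 → s.reg i = ρ i) → ∃ s' t, Exec W (fill A B) s s' t ∧
          t ≤ C * ρ 5 + C ∧ s'.mem = run A B ρ mem (ρ 5) ∧ s'.reg 4 = ρ 5 ∧
            ∀ i < 6, i ≠ 4 → s'.reg i = ρ i := by
  obtain ⟨CA, hCA⟩ := exec_compile 6 A hA
  obtain ⟨CB, hCB⟩ := exec_compile 6 B hB
  set C := CA + CB + 4 with hC
  refine ⟨C, fun X hX ρ mem hρ hrun W hW => ?_⟩
  have mono : ∀ {D : ℕ}, D ≤ C → D * X ^ D ≤ W :=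
    fun h => le_trans (Nat.mul_le_mul h (Nat.pow_le_pow_right hX h)) hW
  have hXW : X ≤ W := by simpa using mono (D := 1) (by omega)
  -- Induction on the number `l` of remaining rounds, because the loop unfolds at its front.
  suffices h : ∀ l q, q + l = ρ 5 → ∀ s : State, s.mem = run A B ρ mem q → s.reg 4 = q →
      (∀ i < 6, i ≠ 4 → s.reg i = ρ i) → ∃ s' t, Exec W (fill A B) s s' t ∧
        t ≤ C * l + C ∧ s'.mem = run A B ρ mem (ρ 5) ∧ s'.reg 4 = ρ 5 ∧
          ∀ i < 6, i ≠ 4 → s'.reg i = ρ i by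
    exact fun s hs h4 hr => h (ρ 5) 0 (by omega) s hs h4 hr
  intro l
  induction l with
  | zero =>
    intro q hq s hs h4 hr
    refine ⟨s, 1, .loop_false ?_, by omega, ?_, by omega, hr⟩
    · rw [Test.Holds, h4, hr 5 (by omega) (by omega)]
      omega
    · rw [hs, ← hq, add_zero]
  | succ l ih =>
    intro q hq s hs h4 hr
    have hρ5 := hρ 5 (by omega)
    have hreg : ∀ i < 6, s.reg i = Function.update ρ 4 q i := fun i hi => by
      by_cases hi4 : i = 4
      · rw [hi4, h4, Function.update_self]
      · rw [hr i hi hi4, Function.update_of_ne hi4]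
    have hregX : ∀ i < 6, s.reg i ≤ X := fun i hi => by
      by_cases hi4 : i = 4
      · rw [hi4, h4]; omega
      · rw [hr i hi hi4]; exact hρ i hi
    have hmemX : ∀ p, s.mem p ≤ X := fun p => hs ▸ hrun q (by omega) p
    obtain ⟨bA, h⟩ := hCA X hX s hregX hmemX
    obtain ⟨s₁, t₁, e₁, ht₁, hm₁, hr₁, hv₁⟩ := h W (mono (by omega)) 6 le_rfl
    obtain ⟨bB, h⟩ := hCB X hX s₁ (fun i hi => hr₁ i hi ▸ hregX i hi) (fun p => hm₁ ▸ hmemX p)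
    obtain ⟨s₂, t₂, e₂, ht₂, hm₂, hr₂, hv₂⟩ := h W (mono (by omega)) 7 (by omega)
    have hA' : s₂.reg 6 = A.eval s := (hr₂ 6 (by omega)).trans hv₁
    have hB' : s₂.reg 7 = B.eval s := hv₂.trans (eval_congr hB hr₁ hm₁)
    have e₃ : Exec W (.store 6 7) s₂ _ 1 := .store 6 7 s₂
      (hA'.symm ▸ bA.trans (mono (by omega)))
      (hv₂.symm ▸ bB.trans (mono (by omega)))
    have e₄ : Exec W (.assign 8 (.const 1)) (s₂.setMem (s₂.reg 6) (s₂.reg 7)) _ 1 :=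
      .assign 8 (.const 1) _ (hX.trans hXW)
    have h₂4 : s₂.reg 4 = q := by rw [hr₂ 4 (by omega), hr₁ 4 (by omega), h4]
    have hval : (Rhs.add 4 8).eval ((s₂.setMem (s₂.reg 6) (s₂.reg 7)).setReg 8 1) = q + 1 := by
      simp [Rhs.eval, State.setReg, State.setMem, h₂4]
    have e₅ := Exec.assign (W := W) 4 (.add 4 8)
      ((s₂.setMem (s₂.reg 6) (s₂.reg 7)).setReg 8 1) (by rw [hval]; omega)
    rw [hval] at e₅
    obtain ⟨s', t, e, ht, hm, h4', hr'⟩ := ih (q + 1) (by omega)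
      (((s₂.setMem (s₂.reg 6) (s₂.reg 7)).setReg 8 1).setReg 4 (q + 1))
      (by
        simp only [State.setReg, State.setMem]
        rw [hA', hB', hm₂, hm₁, run, hs]
        congr 1 <;> exact eval_congr ‹_› hreg hs)
      (by simp [State.setReg])
      (fun i hi hi4 => by
        simp only [State.setReg, State.setMem]
        rw [Function.update_of_ne hi4, Function.update_of_ne (by omega), hr₂ i (by omega),
          hr₁ i hi, hr i hi hi4])
    refine ⟨s', _, .loop_true ?_ (.seq e₁ (.seq e₂ (.seq e₃ (.seq e₄ e₅)))) e, ?_, hm, h4', hr'⟩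
    · rw [Test.Holds, h4, hr 5 (by omega) (by omega)]
      omega
    · rw [mul_add, mul_one]
      omega

end Ex

end WordRAM

/-! ### Numbering of squares and table entries -/

namespace FloodIt

open WordRAM

section Index

variable {k n c : ℕ}

/-- The number of a square in the row by row enumeration of the board. -/
def index (x : Square k n) : ℕ := finProdFinEquiv x

theorem index_eq (x : Square k n) : index x = x.2 + n * x.1 := rfl

theorem index_lt (x : Square k n) : index x < k * n := (finProdFinEquiv x).2

theorem index_injective : Function.Injective (index (k := k) (n := n)) :=
  Fin.val_injective.comp finProdFinEquiv.injective

theorem exists_index_eq {p : ℕ} (hp : p < k * n) : ∃ x : Square k n, index x = p :=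
  ⟨finProdFinEquiv.symm ⟨p, hp⟩, by rw [index, Equiv.apply_symm_apply]⟩

theorem index_mod (x : Square k n) : index x % n = x.2 := by
  rw [index_eq, Nat.add_mul_mod_self_left, Nat.mod_eq_of_lt x.2.2]

theorem index_div (x : Square k n) : index x / n = x.1 := by
  rw [index_eq, Nat.add_mul_div_left _ _ x.2.pos, Nat.div_eq_of_lt x.2.2, zero_add]

/-- The square number `q` is the neighbour of the square number `p` in the next row (if `b = 0`)
or the next column (if `b = 1`). -/
def Next (n b p q : ℕ) : Prop := b = 0 ∧ q = p + n ∨ b = 1 ∧ q = p + 1 ∧ q % n ≠ 0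

theorem Next.adj {b : ℕ} {x y : Square k n} (h : Next n b (index x) (index y)) :
    (boardGraph k n).Adj x y := by
  have hn : 0 < n := x.2.pos
  rw [boardGraph_adj]
  rcases h with ⟨-, h⟩ | ⟨-, h, h'⟩
  · have h₁ := congrArg (· % n) h
    have h₂ := congrArg (· / n) h
    simp only [Nat.add_mod_right, index_mod, Nat.add_div_right _ hn, index_div] at h₁ h₂
    exact .inl ⟨.inl h₂.symm, Fin.ext h₁.symm⟩
  · rw [index_mod] at h'
    rw [index_eq, index_eq] at h
    have hx := x.2.2
    have hy := y.2.2
    -- Consecutive numbers lie in different rows only if the larger one starts a row, which `h'`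
    -- excludes.
    have h₁ : (x.1 : ℕ) = y.1 := by
      rcases lt_trichotomy (x.1 : ℕ) y.1 with h₁ | h₁ | h₁
      · nlinarith [Nat.mul_le_mul_left n h₁, Nat.pos_of_ne_zero h']
      · exact h₁
      · nlinarith [Nat.mul_le_mul_left n h₁]
    refine .inr ⟨.inl ?_, Fin.ext h₁⟩
    rw [h₁] at h
    omega

theorem exists_next {x y : Square k n} (h : (boardGraph k n).Adj x y) :
    ∃ b < 2, Next n b (index x) (index y) ∨ Next n b (index y) (index x) := by
  have down : ∀ x y : Square k n, (x.1 : ℕ) + 1 = y.1 → x.2 = y.2 →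
      Next n 0 (index x) (index y) := fun x y h h' =>
    .inl ⟨rfl, by rw [index_eq, index_eq, ← h, h']; ring⟩
  have right : ∀ x y : Square k n, (x.2 : ℕ) + 1 = y.2 → x.1 = y.1 →
      Next n 1 (index x) (index y) := fun x y h h' =>
    .inr ⟨rfl, by rw [index_eq, index_eq, ← h, h']; ring, by rw [index_mod]; omega⟩
  rcases boardGraph_adj.1 h with ⟨h | h, h'⟩ | ⟨h | h, h'⟩
  · exact ⟨0, by omega, .inl (down x y h h')⟩
  · exact ⟨0, by omega, .inr (down y x h h'.symm)⟩
  · exact ⟨1, by omega, .inl (right x y h h')⟩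
  · exact ⟨1, by omega, .inr (right y x h h'.symm)⟩

/-- The address of the entry of the table for the squares number `p` and `q` and colour `d`. -/
def addr (N c p q d : ℕ) : ℕ := N + (d + c * (q + N * p))

theorem addr_injective {N p q d p' q' d' : ℕ} (hq : q < N) (hd : d < c) (hq' : q' < N)
    (hd' : d' < c) (h : addr N c p q d = addr N c p' q' d') : p = p' ∧ q = q' ∧ d = d' := by
  have h : d + c * (q + N * p) = d' + c * (q' + N * p') := Nat.add_left_cancel h
  have h₁ := congrArg (· % c) h
  have h₂ := congrArg (· / c) h
  simp only [Nat.add_mul_mod_self_left, Nat.mod_eq_of_lt, Nat.add_mul_div_left _ _ (Nat.zero_lt_of_lt hd),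
    Nat.div_eq_of_lt, hd, hd', zero_add] at h₁ h₂
  have h₃ := congrArg (· % N) h₂
  have h₄ := congrArg (· / N) h₂
  simp only [Nat.add_mul_mod_self_left, Nat.mod_eq_of_lt, Nat.add_mul_div_left _ _ (Nat.zero_lt_of_lt hq),
    Nat.div_eq_of_lt, hq, hq', zero_add] at h₃ h₄
  exact ⟨h₄, h₃, h₁⟩

/-- The table stored in the memory. -/
def table (mem : ℕ → ℕ) (u v : Square k n) (d : Fin c) : ℕ :=
  mem (addr (k * n) c (index u) (index v) d)

end Index

/-! ### The initial table -/

section Init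

/-- The address of the cell of the table that is initialised in the current round. -/
def initAddr : Ex := .reg 3 + .reg 4

/-- The initial value of an entry of the table for `c` colours. -/
def initVal (c : ℕ) : Ex :=
  let d : Ex := .reg 4 % .const c
  let v : Ex := .reg 4 / .const c % .reg 3
  let u : Ex := .reg 4 / .const c / .reg 3
  .ifLt u v (.reg 3) (.ifLt v u (.reg 3)
    (.ifLt (.load u) d (.const 1) (.ifLt d (.load u) (.const 1) (.const 0))))

theorem initAddr_uses : initAddr.Uses 6 := by simp [initAddr]

theorem initVal_uses (c : ℕ) : (initVal c).Uses 6 := by simp [initVal]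

variable {k n c : ℕ} {ρ mem : ℕ → ℕ} {N : ℕ}

/-- The table lies above the input, so the colours remain readable throughout the initialisation. -/
theorem run_init_of_lt (hN : ρ 3 = N) {p : ℕ} (hp : p < N) (q : ℕ) :
    Ex.run initAddr (initVal c) ρ mem q p = mem p := by
  induction q with
  | zero => rfl
  | succ q ih =>
    rw [Ex.run, Function.update_of_ne, ih]
    simp [initAddr, hN]
    omega

theorem run_init_le {X : ℕ} (hN : ρ 3 ≤ X) (hX : 1 ≤ X) (hmem : ∀ p, mem p ≤ X) (q p : ℕ) :
    Ex.run initAddr (initVal c) ρ mem q p ≤ X := by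
  induction q generalizing p with
  | zero => exact hmem p
  | succ q ih =>
    rw [Ex.run, Function.update_apply]
    split_ifs
    · simp only [initVal, Ex.eval_ifLt, Ex.eval_reg, Ex.eval_const]
      have : Function.update ρ 4 q 3 = ρ 3 := by simp
      rw [this]
      split_ifs <;> omega
    · exact ih p

theorem run_init_addr (hN : ρ 3 = N) {u v d : ℕ} (hu : u < N) (hv : v < N) (hd : d < c) {q : ℕ}
    (hq : d + c * (v + N * u) < q) :
    Ex.run initAddr (initVal c) ρ mem q (addr N c u v d) =
      if u = v then (if mem u = d then 0 else 1) else N := by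
  induction q with
  | zero => omega
  | succ q ih =>
    rw [Ex.run, Function.update_apply]
    have hreg : Function.update ρ 4 q 3 = N := by simp [hN]
    by_cases hq' : q = d + c * (v + N * u)
    · have h₁ : q % c = d := by rw [hq', Nat.add_mul_mod_self_left, Nat.mod_eq_of_lt hd]
      have h₂ : q / c = v + N * u := by
        rw [hq', Nat.add_mul_div_left _ _ (Nat.zero_lt_of_lt hd), Nat.div_eq_of_lt hd, zero_add]
      have h₃ : q / c % N = v := by rw [h₂, Nat.add_mul_mod_self_left, Nat.mod_eq_of_lt hv]
      have h₄ : q / c / N = u := by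
        rw [h₂, Nat.add_mul_div_left _ _ (Nat.zero_lt_of_lt hv), Nat.div_eq_of_lt hv, zero_add]
      have hmem := run_init_of_lt (c := c) (mem := mem) hN hu q
      rw [if_pos (by simp [initAddr, addr, ← hq', hN])]
      generalize Ex.run initAddr (initVal c) ρ mem q = mem' at hmem
      simp only [initVal, Ex.eval_ifLt, Ex.eval_reg, Ex.eval_const, Ex.eval_mod, Ex.eval_div,
        Ex.eval_load, hreg, Function.update_self, h₁, h₃, h₄, hmem]
      split_ifs <;> omega
    · rw [if_neg, ih (by omega)]
      simp [initAddr, addr, hN]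
      omega

end Init

/-! ### Relaxation of the table -/

section Relax

/-- The digits of the counter: `e`, `d` (colours), `b₁` (direction), `b₂` (orientation), `x`, `v`,
`u` (squares). -/
def digitE (c : ℕ) : Ex := .reg 4 % .const c
def digitD (c : ℕ) : Ex := .reg 4 / .const c % .const c
def digitB₁ (c : ℕ) : Ex := .reg 4 / .const c / .const c % .const 2
def digitB₂ (c : ℕ) : Ex := .reg 4 / .const c / .const c / .const 2 % .const 2
def digitX (c : ℕ) : Ex := .reg 4 / .const c / .const c / .const 2 / .const 2 % .reg 3
def digitV (c : ℕ) : Ex := .reg 4 / .const c / .const c / .const 2 / .const 2 / .reg 3 % .reg 3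
def digitU (c : ℕ) : Ex :=
  .reg 4 / .const c / .const c / .const 2 / .const 2 / .reg 3 / .reg 3 % .reg 3

/-- `addr` as an expression. -/
def addrEx (c : ℕ) (p q d : Ex) : Ex := .reg 3 + (d + .const c * (q + .reg 3 * p))

def relaxAddr (c : ℕ) : Ex := addrEx c (digitU c) (digitV c) (digitE c)

/-- `y` follows `x` in the direction given by `b₁`, and `b₂` orients the edge. If `y` is off the
board or has wrapped to a new row, the old entry is written back. -/
def relaxVal (c : ℕ) : Ex :=
  let e := digitE c
  let d := digitD c
  let u := digitU c
  let v := digitV c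
  let y := digitX c + .ifLt (digitB₁ c) (.const 1) (.reg 0) (.const 1)
  let p : Ex := .ifLt (digitB₂ c) (.const 1) (digitX c) y
  let q : Ex := .ifLt (digitB₂ c) (.const 1) y (digitX c)
  let old : Ex := .load (addrEx c u v e)
  let cand : Ex := .load (addrEx c u p d) + .load (addrEx c q v d) +
    .ifLt d e (.const 1) (.ifLt e d (.const 1) (.const 0))
  let new : Ex := .ifLt cand old cand old
  .ifLt y (.reg 3) (.ifLt (digitB₁ c) (.const 1) new (.ifLt (.const 0) (y % .reg 0) new old)) old

theorem relaxAddr_uses (c : ℕ) : (relaxAddr c).Uses 6 := by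
  simp [relaxAddr, addrEx, digitU, digitV, digitE]

theorem relaxVal_uses (c : ℕ) : (relaxVal c).Uses 6 := by
  simp [relaxVal, addrEx, digitU, digitV, digitE, digitD, digitX, digitB₁, digitB₂]

variable {k n c : ℕ} {s : State}

theorem eval_addrEx (h3 : s.reg 3 = k * n) (p q d : Ex) :
    (addrEx c p q d).eval s = addr (k * n) c (p.eval s) (q.eval s) (d.eval s) := by
  simp [addrEx, addr, h3]

/-- Entries never increase; both the comparison between rounds and the word bound rest on this. -/
theorem relaxVal_le (s : State) : (relaxVal c).eval s ≤ s.mem ((relaxAddr c).eval s) := by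
  simp only [relaxVal, relaxAddr, Ex.eval_ifLt, Ex.eval_load]
  have key : ∀ a b : ℕ, (if a < b then a else b) ≤ b := fun a b => by split_ifs <;> omega
  split_ifs
  all_goals first | exact le_rfl | exact key _ _

/-- The value written in a relaxation is the old one, or it comes from two neighbouring squares. -/
theorem eval_relaxVal_cases (h0 : s.reg 0 = n) (h3 : s.reg 3 = k * n) (hkn : 0 < k * n)
    (hc : 0 < c) : ∃ (u v : Square k n) (e : Fin c),
      (relaxAddr c).eval s = addr (k * n) c (index u) (index v) e ∧
      ((relaxVal c).eval s = table s.mem u v e ∨ ∃ (x y : Square k n) (d : Fin c),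
        (boardGraph k n).Adj x y ∧ (relaxVal c).eval s =
          table s.mem u x d + table s.mem y v d + if d = e then 0 else 1) := by
  have hU : (digitU c).eval s < k * n := by
    rw [digitU, Ex.eval_mod, Ex.eval_reg, h3]; exact Nat.mod_lt _ hkn
  have hV : (digitV c).eval s < k * n := by
    rw [digitV, Ex.eval_mod, Ex.eval_reg, h3]; exact Nat.mod_lt _ hkn
  have hX : (digitX c).eval s < k * n := by
    rw [digitX, Ex.eval_mod, Ex.eval_reg, h3]; exact Nat.mod_lt _ hkn
  have hE : (digitE c).eval s < c := Nat.mod_lt _ hc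
  have hD : (digitD c).eval s < c := Nat.mod_lt _ hc
  have hB₁ : (digitB₁ c).eval s < 2 := Nat.mod_lt _ two_pos
  obtain ⟨u, hu⟩ := exists_index_eq hU
  obtain ⟨v, hv⟩ := exists_index_eq hV
  obtain ⟨x, hx⟩ := exists_index_eq hX
  obtain ⟨e, he⟩ : ∃ e : Fin c, (e : ℕ) = (digitE c).eval s := ⟨⟨_, hE⟩, rfl⟩
  obtain ⟨d, hd⟩ : ∃ d : Fin c, (d : ℕ) = (digitD c).eval s := ⟨⟨_, hD⟩, rfl⟩
  refine ⟨u, v, e, ?_, ?_⟩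
  · rw [relaxAddr, eval_addrEx h3, hu, hv, he]
  have hcol : (if (d : ℕ) < e then 1 else if (e : ℕ) < d then 1 else 0) =
      if d = e then 0 else 1 := by
    simp only [Fin.ext_iff]
    split_ifs <;> omega
  simp only [relaxVal, Ex.eval_ifLt, Ex.eval_load, Ex.eval_add, Ex.eval_mod, Ex.eval_const,
    Ex.eval_reg, eval_addrEx h3, h0, h3, ← hu, ← hv, ← hx, ← he, ← hd, hcol]
  generalize (digitB₁ c).eval s = b₁ at *
  generalize (digitB₂ c).eval s = b₂ at *
  set w := index x + if b₁ < 1 then n else 1 with hw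
  by_cases hwN : w < k * n
  · obtain ⟨y, hy⟩ := exists_index_eq hwN
    simp only [← hy, if_pos (index_lt y)]
    have key : Next n b₁ (index x) (index y) →
        (let cand := table s.mem u (if b₂ < 1 then x else y) d +
            table s.mem (if b₂ < 1 then y else x) v d + if d = e then 0 else 1
          let val := if cand < table s.mem u v e then cand else table s.mem u v e
          val = table s.mem u v e ∨ ∃ (x y : Square k n) (d : Fin c),
            (boardGraph k n).Adj x y ∧ val =
              table s.mem u x d + table s.mem y v d + if d = e then 0 else 1) := by
      intro h
      have hadj : (boardGraph k n).Adj (if b₂ < 1 then x else y) (if b₂ < 1 then y else x) := by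
        split_ifs
        · exact h.adj
        · exact h.adj.symm
      intro cand val
      by_cases hlt : cand < table s.mem u v e
      · exact .inr ⟨_, _, d, hadj, if_pos hlt⟩
      · exact .inl (if_neg hlt)
    simp only [table, apply_ite index] at key ⊢
    by_cases hb : b₁ < 1
    · simp only [if_pos hb] at hw ⊢
      exact key (.inl ⟨by omega, hy.trans hw⟩)
    · simp only [if_neg hb] at hw ⊢
      by_cases hm : 0 < index y % n
      · simp only [if_pos hm]
        exact key (.inr ⟨by omega, hy.trans hw, hm.ne'⟩)
      · simp only [if_neg hm]
        exact .inl trivial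
  · exact .inl (if_neg hwN)

/-- The counter with given digits. -/
def opIndex (c N r u v x b₂ b₁ d e : ℕ) : ℕ :=
  e + c * (d + c * (b₁ + 2 * (b₂ + 2 * (x + N * (v + N * (u + N * r))))))

theorem digit_div {a b q : ℕ} (h : a < b) : (a + b * q) / b = q := by
  rw [Nat.add_mul_div_left _ _ (Nat.zero_lt_of_lt h), Nat.div_eq_of_lt h, zero_add]

theorem digit_lt {a b q m : ℕ} (h : a < b) (hq : q < m) : a + b * q < b * m := by
  nlinarith [Nat.mul_le_mul_left b hq]

/-- The round number is the leading digit, so each round is an interval of counter values containing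
every combination of the other digits. -/
theorem opIndex_bounds {N r u v x b₂ b₁ d e : ℕ} (hu : u < N) (hv : v < N) (hx : x < N)
    (h₂ : b₂ < 2) (h₁ : b₁ < 2) (hd : d < c) (he : e < c) :
    (c * (c * (2 * (2 * (N * (N * N)))))) * r ≤ opIndex c N r u v x b₂ b₁ d e ∧
      opIndex c N r u v x b₂ b₁ d e < (c * (c * (2 * (2 * (N * (N * N)))))) * (r + 1) := by
  constructor
  · calc (c * (c * (2 * (2 * (N * (N * N)))))) * r
        = 0 + c * (0 + c * (0 + 2 * (0 + 2 * (0 + N * (0 + N * (0 + N * r)))))) := by ring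
      _ ≤ opIndex c N r u v x b₂ b₁ d e := by unfold opIndex; gcongr <;> exact Nat.zero_le _
  · calc opIndex c N r u v x b₂ b₁ d e
        < c * (c * (2 * (2 * (N * (N * (N * (r + 1))))))) :=
          digit_lt he (digit_lt hd (digit_lt h₁ (digit_lt h₂ (digit_lt hx (digit_lt hv
            (digit_lt hu r.lt_succ_self))))))
      _ = _ := by ring

/-- A relaxation with given digits makes the entry of the table small. -/
theorem eval_relaxVal_opIndex (h0 : s.reg 0 = n) (h3 : s.reg 3 = k * n) {r b₂ b₁ : ℕ}
    {u v x y : Square k n} {d e : Fin c} (h₂ : b₂ < 2) (h₁ : b₁ < 2)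
    (h : Next n b₁ (index x) (index y))
    (h4 : s.reg 4 = opIndex c (k * n) r (index u) (index v) (index x) b₂ b₁ d e) :
    (relaxAddr c).eval s = addr (k * n) c (index u) (index v) e ∧
      (relaxVal c).eval s ≤ table s.mem u (if b₂ = 0 then x else y) d +
        table s.mem (if b₂ = 0 then y else x) v d + if d = e then 0 else 1 := by
  have hU : (digitU c).eval s = index u := by
    simp [digitU, h3, h4, opIndex, digit_div, Nat.mod_eq_of_lt, index_lt, h₁, h₂]
  have hV : (digitV c).eval s = index v := by
    simp [digitV, h3, h4, opIndex, digit_div, Nat.mod_eq_of_lt, index_lt, h₁, h₂]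
  have hX : (digitX c).eval s = index x := by
    simp [digitX, h3, h4, opIndex, digit_div, Nat.mod_eq_of_lt, index_lt, h₁, h₂]
  have hB₂ : (digitB₂ c).eval s = b₂ := by
    simp [digitB₂, h4, opIndex, digit_div, Nat.mod_eq_of_lt, h₁, h₂]
  have hB₁ : (digitB₁ c).eval s = b₁ := by
    simp [digitB₁, h4, opIndex, digit_div, Nat.mod_eq_of_lt, h₁]
  have hD : (digitD c).eval s = d := by
    simp [digitD, h4, opIndex, digit_div, Nat.mod_eq_of_lt]
  have hE : (digitE c).eval s = e := by
    simp [digitE, h4, opIndex, Nat.mod_eq_of_lt]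
  refine ⟨by rw [relaxAddr, eval_addrEx h3, hU, hV, hE], ?_⟩
  have hcol : (if (d : ℕ) < e then 1 else if (e : ℕ) < d then 1 else 0) =
      if d = e then 0 else 1 := by
    simp only [Fin.ext_iff]
    split_ifs <;> omega
  have hy : index x + (if b₁ = 0 then n else 1) = index y := by
    rcases h with ⟨hb, h⟩ | ⟨hb, h, -⟩ <;> simp [hb, h]
  have hval : (relaxVal c).eval s = if table s.mem u (if b₂ = 0 then x else y) d +
        table s.mem (if b₂ = 0 then y else x) v d + (if d = e then 0 else 1) < table s.mem u v e
      then table s.mem u (if b₂ = 0 then x else y) d +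
        table s.mem (if b₂ = 0 then y else x) v d + (if d = e then 0 else 1)
      else table s.mem u v e := by
    simp only [relaxVal, Ex.eval_ifLt, Ex.eval_load, Ex.eval_add, Ex.eval_mod, Ex.eval_const,
      Ex.eval_reg, eval_addrEx h3, h0, h3, hU, hV, hX, hB₁, hB₂, hD, hE, hcol, hy, if_pos (index_lt y),
      Nat.lt_one_iff, table, apply_ite index]
    rcases h with ⟨hb, -⟩ | ⟨hb, -, hm⟩
    · rw [if_pos hb]
    · rw [if_neg (by omega), if_pos (Nat.pos_of_ne_zero hm)]
  rw [hval]
  split_ifs <;> omega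

variable {ρ mem : ℕ → ℕ}

theorem run_relax_anti {p : ℕ} : Antitone fun q => Ex.run (relaxAddr c) (relaxVal c) ρ mem q p := by
  refine antitone_nat_of_succ_le fun q => ?_
  simp only [Ex.run]
  rw [Function.update_apply]
  split_ifs with h
  · rw [h]
    exact relaxVal_le _
  · exact le_rfl

/-- Soundness: every entry is at all times the cost of some derivation, hence never too small. -/
theorem run_relax_der {ω : Square k n → Fin c} (h0 : ρ 0 = n) (h3 : ρ 3 = k * n)
    (hmem : ∀ u v d, Der (boardGraph k n) ω u v d (table mem u v d)) (q : ℕ)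
    (u v : Square k n) (d : Fin c) : Der (boardGraph k n) ω u v d
      (table (Ex.run (relaxAddr c) (relaxVal c) ρ mem q) u v d) := by
  induction q generalizing u v d with
  | zero => exact hmem u v d
  | succ q ih =>
    rw [table, Ex.run, Function.update_apply]
    split_ifs with h
    · obtain ⟨u', v', e, h', hcases⟩ := eval_relaxVal_cases (c := c)
        (s := ⟨Function.update ρ 4 q, Ex.run (relaxAddr c) (relaxVal c) ρ mem q⟩)
        (by simpa using h0) (by simpa using h3) (Nat.zero_lt_of_lt (index_lt u)) d.pos
      rw [h'] at h
      obtain ⟨hu, hv, hd⟩ := addr_injective (index_lt v) d.2 (index_lt v') e.2 h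
      obtain rfl := index_injective hu
      obtain rfl := index_injective hv
      obtain rfl := Fin.ext hd
      rcases hcases with hval | ⟨x, y, e, hadj, hval⟩ <;> rw [hval]
      · exact ih u v d
      · have := (ih u x e).join hadj (ih y v e)
        split_ifs with he
        · exact he ▸ this
        · exact this.recolour d
    · exact ih u v d

/-- The number of relaxations in a round. -/
def roundLength (c N : ℕ) : ℕ := c * (c * (2 * (2 * (N * (N * N)))))

/-- Updating in place is harmless: entries read in mid-round are at most those at its start, and the
one written can only decrease until its end. -/
theorem table_run_relax_succ_le (h0 : ρ 0 = n) (h3 : ρ 3 = k * n) (r : ℕ)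
    {u v x y : Square k n} {d e : Fin c} (h : (boardGraph k n).Adj x y) :
    table (Ex.run (relaxAddr c) (relaxVal c) ρ mem (roundLength c (k * n) * (r + 1))) u v e ≤
      table (Ex.run (relaxAddr c) (relaxVal c) ρ mem (roundLength c (k * n) * r)) u x d +
      table (Ex.run (relaxAddr c) (relaxVal c) ρ mem (roundLength c (k * n) * r)) y v d +
        if d = e then 0 else 1 := by
  have key : ∀ (x y : Square k n) (b₂ b₁ : ℕ), b₂ < 2 → b₁ < 2 →
      Next n b₁ (index x) (index y) →
      table (Ex.run (relaxAddr c) (relaxVal c) ρ mem (roundLength c (k * n) * (r + 1))) u v e ≤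
        table (Ex.run (relaxAddr c) (relaxVal c) ρ mem (roundLength c (k * n) * r)) u
          (if b₂ = 0 then x else y) d +
        table (Ex.run (relaxAddr c) (relaxVal c) ρ mem (roundLength c (k * n) * r))
          (if b₂ = 0 then y else x) v d + if d = e then 0 else 1 := by
    intro x y b₂ b₁ h₂ h₁ h
    obtain ⟨lo, hi⟩ := opIndex_bounds (r := r) (index_lt u) (index_lt v) (index_lt x) h₂ h₁ d.2 e.2
    set q := opIndex c (k * n) r (index u) (index v) (index x) b₂ b₁ d e
    obtain ⟨hA, hV⟩ := eval_relaxVal_opIndex (c := c)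
      (s := ⟨Function.update ρ 4 q, Ex.run (relaxAddr c) (relaxVal c) ρ mem q⟩)
      (by simpa using h0) (by simpa using h3) (u := u) (v := v) (d := d) (e := e) (r := r) h₂ h₁ h
      (Function.update_self 4 q ρ)
    calc _ ≤ table (Ex.run (relaxAddr c) (relaxVal c) ρ mem (q + 1)) u v e :=
          run_relax_anti (Nat.succ_le_of_lt hi)
      _ = _ := by rw [table, Ex.run, ← hA, Function.update_self]
      _ ≤ _ := hV
      _ ≤ _ := Nat.add_le_add_right (Nat.add_le_add (run_relax_anti lo) (run_relax_anti lo)) _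
  obtain ⟨b₁, hb₁, h | h⟩ := exists_next h
  · simpa using key x y 0 b₁ two_pos hb₁ h
  · simpa using key y x 1 b₁ one_lt_two hb₁ h

/-- After `k * n` rounds the table is exact. -/
theorem linkMovesTo_eq_table {ω : Square k n → Fin c} (h0 : ρ 0 = n) (h3 : ρ 3 = k * n)
    (hmem : ∀ u v d, table mem u v d = if u = v then (if ω u = d then 0 else 1) else k * n)
    (u v : Square k n) (d : Fin c) :
    linkMovesTo (boardGraph k n) ω u v d = (table (Ex.run (relaxAddr c) (relaxVal c) ρ mem
      (roundLength c (k * n) * (k * n))) u v d : ℕ∞) := by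
  refine linkMovesTo_eq (run_relax_der h0 h3 (fun u v d => ?_) _ u v d) fun t ht => ?_
  · rw [hmem]
    split_ifs with h₁ h₂
    · subst h₁ h₂
      exact .single u
    · subst h₁
      exact (Der.single u).recolour d
    -- The default `k * n` stands in for infinity and is itself attainable, by recolouring a simple
    -- path vertex by vertex.
    · simpa using Der.card (ω := ω) (boardGraph_connected u.1.pos u.2.pos) u v d
  · obtain ⟨A, P⟩ := ht.exists_pathDer
    have := P.table_le (M := fun r => table (Ex.run (relaxAddr c) (relaxVal c) ρ mem
      (roundLength c (k * n) * r))) (r := k * n) (fun u => ?_) (fun u d => ?_)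
      (fun r u v d => run_relax_anti (Nat.mul_le_mul_left _ r.le_succ))
      (fun r u v x y d e h => ?_) ?_ d
    · simpa using this
    · rw [mul_zero, Ex.run, hmem, if_pos rfl, if_pos rfl]
    · rw [mul_zero, Ex.run, hmem, if_pos rfl]
      split_ifs <;> omega
    · convert table_run_relax_succ_le h0 h3 r h
    · have := A.card_le_univ
      simp only [Fintype.card_prod, Fintype.card_fin] at this
      omega

end Relax

/-! ### Reading off the minimum over colours -/

section Output

/-- The least entry of the table for the two given squares and the colours `0, …, m`. -/
def minEx (c : ℕ) : ℕ → Ex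
  | 0 => .load (addrEx c (.reg 0 * .reg 1) (.reg 0 - .const 1 + .reg 0 * .reg 2) (.const 0))
  | m + 1 =>
    let a : Ex :=
      .load (addrEx c (.reg 0 * .reg 1) (.reg 0 - .const 1 + .reg 0 * .reg 2) (.const (m + 1)))
    .ifLt a (minEx c m) a (minEx c m)

theorem minEx_uses (c m : ℕ) : (minEx c m).Uses 6 := by
  induction m with
  | zero => simp [minEx, addrEx]
  | succ m ih => simp [minEx, addrEx, ih]

variable {k n c : ℕ} {s : State}

theorem eval_minEx (hn : 0 < n) {i j : Fin k} (h0 : s.reg 0 = n) (h1 : s.reg 1 = i)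
    (h2 : s.reg 2 = j) (h3 : s.reg 3 = k * n) {m : ℕ} (hm : m < c) :
    (∀ d : Fin c, (d : ℕ) ≤ m →
      (minEx c m).eval s ≤ table s.mem (leftSquare hn i) (rightSquare hn j) d) ∧
    ∃ d : Fin c, (minEx c m).eval s = table s.mem (leftSquare hn i) (rightSquare hn j) d := by
  have hl : index (leftSquare hn i) = n * i := by simp [index_eq, leftSquare]
  have hr : index (rightSquare hn j) = n - 1 + n * j := by simp [index_eq, rightSquare]
  have entry : ∀ d : Fin c, (Ex.load (addrEx c (.reg 0 * .reg 1)
      (.reg 0 - .const 1 + .reg 0 * .reg 2) (.const d))).eval s =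
        table s.mem (leftSquare hn i) (rightSquare hn j) d := by
    intro d
    simp [eval_addrEx h3, table, hl, hr, h0, h1, h2]
  induction m with
  | zero =>
    refine ⟨fun d hd => ?_, ⟨0, hm⟩, entry ⟨0, hm⟩⟩
    rw [← entry, Nat.le_zero.1 hd, minEx]
  | succ m ih =>
    obtain ⟨ih₁, d₀, ih₂⟩ := ih (by omega)
    have hlast := entry ⟨m + 1, hm⟩
    simp only at hlast
    rw [minEx, Ex.eval_ifLt, hlast]
    constructor
    · intro d hd
      rcases Nat.le_succ_iff.1 hd with hd | hd
      · have := ih₁ d hd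
        split_ifs <;> omega
      · obtain rfl : d = ⟨m + 1, hm⟩ := Fin.ext hd
        split_ifs <;> omega
    · split_ifs
      · exact ⟨_, rfl⟩
      · exact ⟨d₀, ih₂⟩

end Output

/-- The program for boards with `k` rows and `c` colours. -/
def program (k c : ℕ) : Prog :=
  .seq (Ex.set 3 (.const k * .reg 0))
  (.seq (Ex.set 5 (.const c * (.reg 3 * .reg 3)))
  (.seq (Ex.fill initAddr (initVal c))
  (.seq (Ex.set 4 (.const 0))
  (.seq (Ex.set 5 (.const (c * (c * (2 * 2))) * (.reg 3 * (.reg 3 * (.reg 3 * .reg 3)))))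
  (.seq (Ex.fill (relaxAddr c) (relaxVal c))
  (Ex.set 0 (minEx c (c - 1))))))))

end FloodIt

namespace FloodIt

open WordRAM

/-! ### Correctness and running time of the program -/

section Main

variable {k n c : ℕ}

theorem inputState_mem_index (ω : Square k n → Fin c) (i j : Fin k) (u : Square k n) :
    (inputState ω i j).mem (index u) = ω u := by
  simp only [inputState, dif_pos (index_lt u)]
  congr 2
  exact finProdFinEquiv.symm_apply_apply u

theorem inputState_mem_le (ω : Square k n → Fin c) (i j : Fin k) (p : ℕ) :
    (inputState ω i j).mem p ≤ c := by
  simp only [inputState]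
  split_ifs
  · exact (ω _).2.le
  · exact Nat.zero_le c

/-- A bound, up to the factor `n ^ 4`, for all inputs, memory cells and loop counters. -/
def wordBound (k c : ℕ) : ℕ := c * (c * (2 * 2)) * k ^ 4 + c * k ^ 2 + k + c + 1

/-- One quantity, `wordBound k c * n ^ 4`, dominates the inputs, both loop lengths and all memory
cells, so it serves for word size and time alike. -/
theorem exists_exec_program (k c : ℕ) : ∃ C, ∀ (n : ℕ) (hn : 0 < n) (ω : Square k n → Fin c)
    (i j : Fin k) (W : ℕ), C * (wordBound k c * n ^ 4) ^ C ≤ W →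
      ∃ s t, Exec W (program k c) (inputState ω i j) s t ∧
        t ≤ C * (wordBound k c * n ^ 4) + C ∧
        linkMoves (boardGraph k n) ω (leftSquare hn i) (rightSquare hn j) = (s.reg 0 : ℕ∞) := by
  obtain ⟨C₁, h₁⟩ := Ex.exec_set (a := 3) (e := .const k * .reg 0) (by simp)
  obtain ⟨C₂, h₂⟩ := Ex.exec_set (a := 5) (e := .const c * (.reg 3 * .reg 3)) (by simp)
  obtain ⟨C₃, h₃⟩ := Ex.exec_fill initAddr_uses (initVal_uses c)
  obtain ⟨C₄, h₄⟩ := Ex.exec_set (a := 4) (e := .const 0) (by simp)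
  obtain ⟨C₅, h₅⟩ := Ex.exec_set (a := 5)
    (e := .const (c * (c * (2 * 2))) * (.reg 3 * (.reg 3 * (.reg 3 * .reg 3)))) (by simp)
  obtain ⟨C₆, h₆⟩ := Ex.exec_fill (relaxAddr_uses c) (relaxVal_uses c)
  obtain ⟨C₇, h₇⟩ := Ex.exec_set (a := 0) (minEx_uses c (c - 1))
  set C := C₁ + C₂ + C₃ + C₄ + C₅ + C₆ + C₇ with hC
  refine ⟨C, fun n hn ω i j W hW => ?_⟩
  set X := wordBound k c * n ^ 4 with hX
  have hc : 0 < c := (ω (leftSquare hn i)).pos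
  have hX_eq : X = c * (c * (2 * 2)) * k ^ 4 * n ^ 4 + c * k ^ 2 * n ^ 4 + k * n ^ 4 + c * n ^ 4 +
      n ^ 4 := by rw [hX, wordBound]; ring
  have hn4 : ∀ a, a ≤ a * n ^ 4 := fun a => Nat.le_mul_of_pos_right _ (Nat.pow_pos hn)
  have hn1 : n ≤ n ^ 4 := Nat.le_self_pow (by omega) n
  have hX1 : 1 ≤ X := by have := hn4 1; omega
  have hN : k * n + c ≤ X := by
    have := Nat.mul_le_mul_left k hn1
    have := hn4 c
    omega
  have hk : k ≤ X := by have := hn4 k; omega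
  have hQ : c * (k * n * (k * n)) +
      c * (c * (2 * 2)) * (k * n * (k * n * (k * n * (k * n)))) ≤ X := by
    have e₁ : c * (k * n * (k * n)) = c * k ^ 2 * n ^ 2 := by ring
    have e₂ : c * (c * (2 * 2)) * (k * n * (k * n * (k * n * (k * n)))) =
      c * (c * (2 * 2)) * k ^ 4 * n ^ 4 := by ring
    have : c * k ^ 2 * n ^ 2 ≤ c * k ^ 2 * n ^ 4 :=
      Nat.mul_le_mul_left _ (Nat.pow_le_pow_right hn (by omega))
    omega
  have hi := i.2
  have hj := j.2
  have mono : ∀ {D : ℕ}, D ≤ C → D * X ^ D ≤ W :=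
    fun h => le_trans (Nat.mul_le_mul h (Nat.pow_le_pow_right hX1 h)) hW
  set s₀ := inputState ω i j with hs₀
  have a0 : s₀.reg 0 = n := rfl
  have a1 : s₀.reg 1 = i := rfl
  have a2 : s₀.reg 2 = j := rfl
  have a3 : s₀.reg 3 = 0 := rfl
  have a4 : s₀.reg 4 = 0 := rfl
  have a5 : s₀.reg 5 = 0 := rfl
  have bound : ∀ s : State, s.reg 0 ≤ X → s.reg 1 ≤ X → s.reg 2 ≤ X → s.reg 3 ≤ X → s.reg 4 ≤ X →
      s.reg 5 ≤ X → ∀ r < 6, s.reg r ≤ X := by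
    intro s _ _ _ _ _ _ r hr
    interval_cases r <;> assumption
  have am : ∀ p, s₀.mem p ≤ X := fun p => (inputState_mem_le ω i j p).trans (by omega)
  obtain ⟨s₁, t₁, e₁, ht₁, m₁, r₁, v₁⟩ := h₁ X hX1 s₀
    (bound _ (by omega) (by omega) (by omega) (by omega) (by omega) (by omega)) am W
    (mono (by omega))
  have b0 : s₁.reg 0 = n := r₁ 0 (by omega) (by omega)
  have b1 : s₁.reg 1 = i := r₁ 1 (by omega) (by omega)
  have b2 : s₁.reg 2 = j := r₁ 2 (by omega) (by omega)
  have b3 : s₁.reg 3 = k * n := v₁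
  have b4 : s₁.reg 4 = 0 := r₁ 4 (by omega) (by omega)
  have b5 : s₁.reg 5 = 0 := r₁ 5 (by omega) (by omega)
  obtain ⟨s₂, t₂, e₂, ht₂, m₂, r₂, v₂⟩ := h₂ X hX1 s₁
    (bound _ (by omega) (by omega) (by omega) (by omega) (by omega) (by omega))
    (m₁ ▸ am) W (mono (by omega))
  have c0 : s₂.reg 0 = n := (r₂ 0 (by omega) (by omega)).trans b0
  have c1 : s₂.reg 1 = i := (r₂ 1 (by omega) (by omega)).trans b1
  have c2 : s₂.reg 2 = j := (r₂ 2 (by omega) (by omega)).trans b2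
  have c3 : s₂.reg 3 = k * n := (r₂ 3 (by omega) (by omega)).trans b3
  have c4 : s₂.reg 4 = 0 := (r₂ 4 (by omega) (by omega)).trans b4
  have c5 : s₂.reg 5 = c * (k * n * (k * n)) := by
    rw [v₂, Ex.eval_mul, Ex.eval_mul, Ex.eval_const, Ex.eval_reg, b3]
  have cm : s₂.mem = s₀.mem := m₂.trans m₁
  have hinit : ∀ q p, Ex.run initAddr (initVal c) s₂.reg s₂.mem q p ≤ X := fun q p =>
    run_init_le (by omega) hX1 (by rw [cm]; exact am) q p
  obtain ⟨s₃, t₃, e₃, ht₃, m₃, q₃, r₃⟩ := h₃ X hX1 s₂.reg s₂.mem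
    (bound s₂ (by omega) (by omega) (by omega) (by omega) (by omega) (by omega))
    (fun q _ p => hinit q p) W (mono (by omega)) s₂ rfl c4 (fun _ _ _ => rfl)
  have d0 : s₃.reg 0 = n := (r₃ 0 (by omega) (by omega)).trans c0
  have d1 : s₃.reg 1 = i := (r₃ 1 (by omega) (by omega)).trans c1
  have d2 : s₃.reg 2 = j := (r₃ 2 (by omega) (by omega)).trans c2
  have d3 : s₃.reg 3 = k * n := (r₃ 3 (by omega) (by omega)).trans c3
  have d5 : s₃.reg 5 = c * (k * n * (k * n)) := (r₃ 5 (by omega) (by omega)).trans c5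
  have d4 : s₃.reg 4 ≤ X := by omega
  have dm : ∀ p, s₃.mem p ≤ X := fun p => m₃ ▸ hinit _ p
  obtain ⟨s₄, t₄, e₄, ht₄, m₄, r₄, v₄⟩ := h₄ X hX1 s₃
    (bound _ (by omega) (by omega) (by omega) (by omega) (by omega) (by omega))
    dm W (mono (by omega))
  have f0 : s₄.reg 0 = n := (r₄ 0 (by omega) (by omega)).trans d0
  have f1 : s₄.reg 1 = i := (r₄ 1 (by omega) (by omega)).trans d1
  have f2 : s₄.reg 2 = j := (r₄ 2 (by omega) (by omega)).trans d2
  have f3 : s₄.reg 3 = k * n := (r₄ 3 (by omega) (by omega)).trans d3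
  have f4 : s₄.reg 4 = 0 := v₄
  have f5 : s₄.reg 5 = c * (k * n * (k * n)) := (r₄ 5 (by omega) (by omega)).trans d5
  obtain ⟨s₅, t₅, e₅, ht₅, m₅, r₅, v₅⟩ := h₅ X hX1 s₄
    (bound _ (by omega) (by omega) (by omega) (by omega) (by omega) (by omega))
    (m₄ ▸ dm) W (mono (by omega))
  have g0 : s₅.reg 0 = n := (r₅ 0 (by omega) (by omega)).trans f0
  have g1 : s₅.reg 1 = i := (r₅ 1 (by omega) (by omega)).trans f1
  have g2 : s₅.reg 2 = j := (r₅ 2 (by omega) (by omega)).trans f2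
  have g3 : s₅.reg 3 = k * n := (r₅ 3 (by omega) (by omega)).trans f3
  have g4 : s₅.reg 4 = 0 := (r₅ 4 (by omega) (by omega)).trans f4
  have g5 : s₅.reg 5 = c * (c * (2 * 2)) * (k * n * (k * n * (k * n * (k * n)))) := by
    rw [v₅]
    simp only [Ex.eval_mul, Ex.eval_const, Ex.eval_reg, f3]
  have gm : s₅.mem = s₃.mem := m₅.trans m₄
  have hrelax : ∀ q p, Ex.run (relaxAddr c) (relaxVal c) s₅.reg s₅.mem q p ≤ X := fun q p =>
    (run_relax_anti (Nat.zero_le q)).trans (by change s₅.mem p ≤ X; rw [gm]; exact dm p)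
  obtain ⟨s₆, t₆, e₆, ht₆, m₆, q₆, r₆⟩ := h₆ X hX1 s₅.reg s₅.mem
    (bound s₅ (by omega) (by omega) (by omega) (by omega) (by omega) (by omega))
    (fun q _ p => hrelax q p) W (mono (by omega)) s₅ rfl g4 (fun _ _ _ => rfl)
  have l0 : s₆.reg 0 = n := (r₆ 0 (by omega) (by omega)).trans g0
  have l1 : s₆.reg 1 = i := (r₆ 1 (by omega) (by omega)).trans g1
  have l2 : s₆.reg 2 = j := (r₆ 2 (by omega) (by omega)).trans g2
  have l3 : s₆.reg 3 = k * n := (r₆ 3 (by omega) (by omega)).trans g3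
  have l4 : s₆.reg 4 ≤ X := by omega
  have l5 : s₆.reg 5 = c * (c * (2 * 2)) * (k * n * (k * n * (k * n * (k * n)))) :=
    (r₆ 5 (by omega) (by omega)).trans g5
  obtain ⟨s₇, t₇, e₇, ht₇, m₇, r₇, v₇⟩ := h₇ X hX1 s₆
    (bound _ (by omega) (by omega) (by omega) (by omega) (by omega) (by omega))
    (fun p => m₆ ▸ hrelax _ p) W (mono (by omega))
  refine ⟨s₇, _, .seq e₁ (.seq e₂ (.seq e₃ (.seq e₄ (.seq e₅ (.seq e₆ e₇))))), ?_, ?_⟩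
  · rw [c5] at ht₃
    rw [g5] at ht₆
    have p₃ : C₃ * (c * (k * n * (k * n))) ≤ C * (c * (k * n * (k * n))) :=
      Nat.mul_le_mul_right _ (by omega)
    have p₆ := Nat.mul_le_mul_right
      (c * (c * (2 * 2)) * (k * n * (k * n * (k * n * (k * n))))) (show C₆ ≤ C by omega)
    have p := Nat.mul_le_mul_left C hQ
    rw [mul_add] at p
    omega
  · have hmem : ∀ (u v : Square k n) (d : Fin c),
        table s₅.mem u v d = if u = v then (if ω u = d then 0 else 1) else k * n := by
      intro u v d
      have hlt : (d : ℕ) + c * (index v + k * n * index u) < c * (k * n * (k * n)) :=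
        digit_lt d.2 (digit_lt (index_lt v) (index_lt u))
      rw [table, gm, m₃, c5, run_init_addr c3 (index_lt u) (index_lt v) d.2 hlt, cm,
        inputState_mem_index]
      simp only [index_injective.eq_iff, Fin.ext_iff]
    -- The second loop is exactly `k * n` full rounds.
    have hQ₂ : s₅.reg 5 = roundLength c (k * n) * (k * n) := by rw [g5, roundLength]; ring
    have htable : ∀ d, linkMovesTo (boardGraph k n) ω (leftSquare hn i) (rightSquare hn j) d =
        (table s₆.mem (leftSquare hn i) (rightSquare hn j) d : ℕ∞) := fun d => by
      rw [m₆, hQ₂]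
      exact linkMovesTo_eq_table g0 g3 hmem _ _ d
    obtain ⟨hle, d, hd⟩ := eval_minEx hn l0 l1 l2 l3 (m := c - 1) (c := c) (by omega)
    rw [v₇, linkMoves]
    simp only [htable]
    refine le_antisymm ((iInf_le _ d).trans (by rw [hd])) (le_iInf fun d => ?_)
    exact_mod_cast hle d (by omega)

end Main

end FloodIt

theorem mainTheorem4 (k c : ℕ) :
    ∃ (P : WordRAM.Prog) (K : ℕ), ∀ (n : ℕ) (hn : 0 < n)
      (ω : FloodIt.Square k n → Fin c) (i j : Fin k),
      ∃ (s : WordRAM.State) (t : ℕ),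
        WordRAM.Exec (K * n ^ K) P (FloodIt.inputState ω i j) s t ∧
        t ≤ K * n ^ 4 ∧
        FloodIt.linkMoves (FloodIt.boardGraph k n) ω
          (FloodIt.leftSquare hn i) (FloodIt.rightSquare hn j) = (s.reg 0 : ℕ∞) ∧
        (s.reg 0 : ℕ∞) ≤ FloodIt.floodMoves (FloodIt.boardGraph k n) ω ∧
        FloodIt.floodMoves (FloodIt.boardGraph k n) ω ≤
          (s.reg 0 : ℕ∞) + ((c * (k - 1) : ℕ) : ℕ∞) := by
  obtain ⟨C, hC⟩ := FloodIt.exists_exec_program k c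
  set D := FloodIt.wordBound k c
  -- The first two summands provide the coefficient and the exponent of the word bound `C * (D * n ^
  -- 4) ^ C`; the last one is the time constant.
  refine ⟨FloodIt.program k c, C * D ^ C + 4 * C + (C * D + C), fun n hn ω i j => ?_⟩
  obtain ⟨s, t, he, ht, hs⟩ := hC n hn ω i j
    ((C * D ^ C + 4 * C + (C * D + C)) * n ^ (C * D ^ C + 4 * C + (C * D + C))) (by
      rw [mul_pow, ← pow_mul, ← mul_assoc]
      exact Nat.mul_le_mul (by omega) (Nat.pow_le_pow_right hn (by omega)))
  refine ⟨s, t, he, ht.trans ?_, hs, ?_, ?_⟩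
  · calc C * (D * n ^ 4) + C ≤ C * (D * n ^ 4) + C * n ^ 4 :=
          Nat.add_le_add_left (Nat.le_mul_of_pos_right _ (Nat.pow_pos hn)) _
      _ = (C * D + C) * n ^ 4 := by ring
      _ ≤ _ := Nat.mul_le_mul_right _ (by omega)
  · rw [← hs]
    exact FloodIt.linkMoves_le_floodMoves i.pos hn ω _ _
  · rw [← hs]
    exact FloodIt.floodMoves_le_linkMoves_add hn ω i j
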